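/- **Conventions.** A function $f:\mathbb N\to\mathbb R$ is negligible, $f=\mathrm{negl}(n)$, if for every $c\in\mathbb N$ one has $|f(n)|<n^{-c}$ for all large $n$. $\sigma_r=I/2^r$ is the maximally mixed state of $r$ qubits, and $\|A\|_1=\mathrm{tr}\sqrt{A^\dagger A}$. A *QPT algorithm* is a family (indexed by $n$) of quantum circuits of gates on at most two qubits, with a polynomially bounded number of qubits and gates, which may start with an arbitrary (advice) state on part of its qubits and outputs the result of measuring one qubit; with oracle access to a unitary $U$, it may also apply $U$ to chosen qubits, each query counting as one gate. Let $N(n),\kappa(n)$ be functions $\mathbb N\to\mathbb N$. Unitaries $V_{n,k}$ on $N(n)$ qubits, with keys $k\in\{0,1\}^{\kappa(n)}$, are *pseudorandom unitaries* (PRU) if $\kappa$ is polynomially bounded; circuits of polynomial size compute $V_{n,k}|\psi\rangle$ from $k$ and $|\psi\rangle$; and for every QPT oracle algorithm $\mathcal A$ $$\Big|\Pr_{k}[\mathcal A^{V_{n,k}}=1]-\Pr_{U\leftarrow\mathrm{Haar}}[\mathcal A^{U}=1]\Big|=\mathrm{negl}(n).$$ For a unitary $U$ on $z=n+\ell+m$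 qubits and an $n$-qubit state $\rho$ let $$\Phi_U(\rho)=U\big(\rho\otimes|0\rangle\langle 0|^{\otimes\ell}\otimes\sigma_m\big)U^\dagger .$$ **Theorem.** 1. (Haar twirl.) There is a constant $C$ such that for all $n,\ell,m,t,q\in\mathbb N$ and every state $\rho_g$ of $t(n+q)$ qubits, $$\Big\|\int \big(\Phi_U^{\otimes t}\otimes\mathcal I_{qt}\big)(\rho_g)\,dU-\sigma_z^{\otimes t}\otimes\mathrm{tr}_{nt}(\rho_g)\Big\|_1\le C\,\frac{t^2}{2^m},\qquad z=n+\ell+m,$$ where $dU$ is the Haar probability measure on the unitaries of $z$ qubits, $\mathcal I_{qt}$ is the identity channel on $qt$ qubits, and $\mathrm{tr}_{nt}$ is the partial trace over the $nt$ qubits on which $\Phi_U^{\otimes t}$ acts. 2. (Semantic security.) Let $\ell=\ell(n)$, $m=m(n)=\omega(\log n)$, $z=n+\ell+m$, and let $t=t(n)$ be polynomially bounded. Let $U_k=V^{(1)}_{k_1}V^{(2)}_{k_2}V^{(3)}_{k_3}$ for a uniformly random key $k=(k_1,k_2,k_3)$ of three bit strings, where $V^{(1)}$ is a family of pseudorandom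 unitaries on $z$ qubits, and $V^{(2)},V^{(3)}$ are arbitrary keyed families of unitaries on $z$ qubits (in the pseudorandom quantum authentication scheme, PQAS: an approximate 4-design and an exact 2-design). Let $\Phi_k=\Phi_{U_k}$. Then for every $q=q(n)$, all states $\rho_g=\rho_g(n)$ of $t(n+q)$ qubits, and every QPT algorithm $\mathcal A$, $$\Big|\Pr_{k}\big[\mathcal A\big((\Phi_k^{\otimes t}\otimes\mathcal I_{qt})(\rho_g)\big)=1\big]-\Pr\big[\mathcal A\big(\sigma_z^{\otimes t}\otimes\mathrm{tr}_{nt}(\rho_g)\big)=1\big]\Big|=\mathrm{negl}(n).$$ In particular, for all $n$-qubit states $\rho=\rho(n)$ and every QPT algorithm $\mathcal A$, $$\Big|\Pr_{k}\big[\mathcal A\big(\Phi_k(\rho)^{\otimes t}\big)=1\big]-\Pr\big[\mathcal A\big(\sigma_z^{\otimes t}\big)=1\big]\Big|=\mathrm{negl}(n).$$ -/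

import Mathlib

open scoped MatrixOrder ComplexOrder

namespace QCrypto

/-! Registers of qubits, operators and states -/

/-- The computational basis of a register whose qubits are labelled by `ι`. -/
abbrev Conf (ι : Type) : Type := ι → Bool

/-- Operators on the Hilbert space `(ℂ²)^{⊗ι}` of that register, as matrices in the
computational basis. -/
abbrev Op (ι : Type) : Type := Matrix (Conf ι) (Conf ι) ℂ

/-- The unitary group of the register labelled by `ι`. -/
abbrev UGroup (ι : Type) [Fintype ι] [DecidableEq ι] : Type := Matrix.unitaryGroup (Conf ι) ℂ

/-- Density operators (quantum states). -/
def IsDensity {ι : Type} [Fintype ι] [DecidableEq ι] (ρ : Op ι) : Prop :=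
  ρ.PosSemidef ∧ ρ.trace = 1

/-- Tensor product of two operators. -/
noncomputable def tensor {ι κ : Type} (A : Op ι) (B : Op κ) : Op (ι ⊕ κ) :=
  fun x y => A (x ∘ Sum.inl) (y ∘ Sum.inl) * B (x ∘ Sum.inr) (y ∘ Sum.inr)

/-- Tensor power `A^{⊗t}`; the qubit `i` of the `j`-th copy has the label `(j, i)`. -/
noncomputable def tensorPow {ι : Type} (t : ℕ) (A : Op ι) : Op (Fin t × ι) :=
  fun x y => ∏ j : Fin t, A (fun i => x (j, i)) (fun i => y (j, i))

/-- Renaming the qubits of a register. -/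
def relabel {ι κ : Type} (e : ι ≃ κ) (A : Op ι) : Op κ :=
  fun x y => A (x ∘ e) (y ∘ e)

/-- Partial trace over the first of two registers. -/
noncomputable def traceLeft {ι κ : Type} [Fintype ι] [DecidableEq ι] (ρ : Op (ι ⊕ κ)) : Op κ :=
  fun x y => ∑ a : Conf ι, ρ (Sum.elim a x) (Sum.elim a y)

/-- Partial trace over the second of two registers. -/
noncomputable def traceRight {ι κ : Type} [Fintype κ] [DecidableEq κ] (ρ : Op (ι ⊕ κ)) : Op ι :=
  fun x y => ∑ b : Conf κ, ρ (Sum.elim x b) (Sum.elim y b)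

/-- The maximally mixed state `σ = I / 2^{#ι}`. -/
noncomputable def maxMixed (ι : Type) [Fintype ι] [DecidableEq ι] : Op ι :=
  ((2 : ℂ) ^ Fintype.card ι)⁻¹ • (1 : Op ι)

/-- The computational basis state `|s⟩⟨s|`. -/
noncomputable def basisState {ι : Type} [Fintype ι] [DecidableEq ι] (s : Conf ι) : Op ι :=
  Matrix.single s s 1

/-- The state `|0⟩⟨0|` of all qubits of the register. -/
noncomputable def zeroState (ι : Type) [Fintype ι] [DecidableEq ι] : Op ι :=
  basisState fun _ => false

/-- The trace norm `‖A‖₁ = tr √(A† A)`. -/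
noncomputable def traceNorm {ι : Type} [Fintype ι] [DecidableEq ι] (A : Op ι) : ℝ :=
  (CFC.sqrt (A.conjTranspose * A)).trace.re

/-- The action on `ρ` of `Φ^{⊗t} ⊗ id`, where `Φ` is a linear map from operators on `ι` to
operators on `ι'`, and `id` is the identity channel on the register `κ`. (Expand the first
part of `ρ` in matrix units, and apply `Φ` to each of the `t` factors of a unit.) -/
noncomputable def parallel {ι ι' κ : Type} [Fintype ι] [DecidableEq ι] (t : ℕ)
    (Φ : Op ι →ₗ[ℂ] Op ι') (ρ : Op ((Fin t × ι) ⊕ κ)) : Op ((Fin t × ι') ⊕ κ) :=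
  fun x y => ∑ a : Fin t → Conf ι, ∑ b : Fin t → Conf ι,
    (∏ j : Fin t, Φ (Matrix.single (a j) (b j) 1)
      (fun i => x (Sum.inl (j, i))) (fun i => y (Sum.inl (j, i)))) *
    ρ (Sum.elim (fun p => a p.1 p.2) (x ∘ Sum.inr)) (Sum.elim (fun p => b p.1 p.2) (y ∘ Sum.inr))

/-! The Haar probability measure -/

/-- The Borel sets of the unitary group. -/
noncomputable instance instMeasurableSpaceUGroup (ι : Type) [Fintype ι] [DecidableEq ι] :
    MeasurableSpace (UGroup ι) := borel _

instance instBorelSpaceUGroup (ι : Type) [Fintype ι] [DecidableEq ι] :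
    BorelSpace (UGroup ι) := ⟨rfl⟩

instance instCompactSpaceUGroup (ι : Type) [Fintype ι] [DecidableEq ι] :
    CompactSpace (UGroup ι) := by
  refine isCompact_iff_compactSpace.1 ?_
  have hs : IsCompact (X := Op ι) (Set.univ.pi fun _ : Conf ι => Set.univ.pi fun _ : Conf ι =>
      Metric.closedBall (0 : ℂ) 1) :=
    isCompact_univ_pi fun _ => isCompact_univ_pi fun _ => isCompact_closedBall _ _
  refine IsCompact.of_isClosed_subset hs ?_ ?_
  · have h : ((Matrix.unitaryGroup (Conf ι) ℂ : Submonoid (Op ι)) : Set (Op ι)) =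
        {A | star A * A = 1} ∩ {A | A * star A = 1} := by
      ext A
      exact Unitary.mem_iff
    rw [h]
    exact (isClosed_eq (by fun_prop) continuous_const).inter
      (isClosed_eq (by fun_prop) continuous_const)
  · intro A hA
    refine fun i _ j _ => mem_closedBall_zero_iff.2 ?_
    exact entry_norm_bound_of_unitary hA i j

/-- The Haar probability measure on the unitary group of a register. -/
noncomputable def haarU (ι : Type) [Fintype ι] [DecidableEq ι] : MeasureTheory.Measure (UGroup ι) :=
  MeasureTheory.Measure.haarMeasure ⊤

/-! Asymptotics -/

/-- Negligible functions, that is `|f n| < n^{-c}` for each `c` and all large `n`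
(see `negligible_iff`). -/
def Negligible (f : ℕ → ℝ) : Prop :=
  Asymptotics.SuperpolynomialDecay Filter.atTop (fun n : ℕ => (n : ℝ)) f

theorem negligible_iff (f : ℕ → ℝ) :
    Negligible f ↔ ∀ c : ℕ, ∃ n₀ : ℕ, ∀ n > n₀, |f n| < ((n : ℝ) ^ c)⁻¹ := by
  constructor
  · intro h c
    obtain ⟨n₀, hn⟩ := Filter.eventually_atTop.1 (((tendsto_zero_iff_abs_tendsto_zero _).1
      (h c)).eventually (gt_mem_nhds zero_lt_one))
    refine ⟨n₀, fun n hn' => ?_⟩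
    have hpos : (0 : ℝ) < (n : ℝ) ^ c := pow_pos (by exact_mod_cast (by omega)) c
    have h2 := hn n hn'.le
    simp only [Function.comp_apply, abs_mul, abs_of_pos hpos] at h2
    rw [inv_eq_one_div, lt_div_iff₀ hpos]
    linarith
  · intro h c
    rw [tendsto_zero_iff_abs_tendsto_zero]
    obtain ⟨n₀, hn⟩ := h (c + 1)
    refine squeeze_zero' (Filter.Eventually.of_forall fun n => abs_nonneg _) ?_
      (tendsto_inv_atTop_nhds_zero_nat (𝕜 := ℝ))
    filter_upwards [Filter.eventually_gt_atTop n₀] with n hn'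
    have hn0 : (0 : ℝ) < n := by exact_mod_cast (by omega)
    have h2 := (hn n hn').le
    simp only [Function.comp_apply, abs_mul, abs_of_pos (pow_pos hn0 c)]
    calc (n : ℝ) ^ c * |f n| ≤ (n : ℝ) ^ c * ((n : ℝ) ^ (c + 1))⁻¹ := by gcongr
      _ = (n : ℝ)⁻¹ := by field_simp; ring

/-- Functions bounded by a polynomial. -/
def PolyBounded (f : ℕ → ℕ) : Prop :=
  ∃ c : ℕ, ∀ n, f n ≤ n ^ c + c

/-- The average over a uniformly random element of a finite set (of keys). -/
noncomputable def uniformAvg {K : Type} [Fintype K] (f : K → ℝ) : ℝ :=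
  (∑ k, f k) / Fintype.card K

/-! Quantum circuits -/

open Classical in
/-- The operator `u`, acting on the qubits `f i` of the register `ι` and as the identity on all
other qubits. -/
noncomputable def actOn {ι κ : Type} (f : κ ↪ ι) (u : Op κ) : Op ι :=
  fun x y => if ∀ i, i ∉ Set.range f → x i = y i then u (x ∘ f) (y ∘ f) else 0

/-- An elementary gate: a unitary on at most two qubits of the register. -/
structure Gate (ι : Type) where
  arity : ℕ
  arity_le : arity ≤ 2
  wires : Fin arity ↪ ι
  unitary : UGroup (Fin arity)

/-- The unitary operator that a gate applies to the register. -/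
noncomputable def Gate.op {ι : Type} (g : Gate ι) : Op ι :=
  actOn g.wires (g.unitary : Op (Fin g.arity))

/-- The operator of a circuit; the head of the list is applied first. -/
noncomputable def circuitOp {ι : Type} [Fintype ι] [DecidableEq ι] : List (Gate ι) → Op ι
  | [] => 1
  | g :: C => circuitOp C * g.op

/-- The operator of a circuit which may query an oracle for the `N`-qubit unitary `U`. An
instruction is a gate or a query, which applies `U` to `N` chosen qubits of the register. -/
noncomputable def oracleCircuitOp {ι : Type} [Fintype ι] [DecidableEq ι] {N : ℕ}
    (U : UGroup (Fin N)) : List (Gate ι ⊕ (Fin N ↪ ι)) → Op ι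
  | [] => 1
  | Sum.inl g :: C => oracleCircuitOp U C * g.op
  | Sum.inr f :: C => oracleCircuitOp U C * actOn f (U : Op (Fin N))

/-- The probability that a measurement of the qubit `i` in the computational basis gives `1`. -/
noncomputable def probOne {ι : Type} [Fintype ι] [DecidableEq ι] (i : ι) (ρ : Op ι) : ℝ :=
  ∑ x : Conf ι, if x i = true then (ρ x x).re else 0

/-- A quantum algorithm with a one-bit output, for an input state on the register `ι`: it holds a
further register with an advice state (work qubits in the state `|0⟩` included), runs a circuit on
both registers and measures one qubit. -/
structure Distinguisher (ι : Type) where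
  work : ℕ
  advice : Op (Fin work)
  advice_isDensity : IsDensity advice
  circuit : List (Gate (ι ⊕ Fin work))
  out : ι ⊕ Fin work

/-- The size of the algorithm: number of its qubits plus number of its gates. -/
def Distinguisher.size {ι : Type} [Fintype ι] (A : Distinguisher ι) : ℕ :=
  Fintype.card ι + A.work + A.circuit.length

/-- `Pr[A(ρ) = 1]`. -/
noncomputable def Distinguisher.prob {ι : Type} [Fintype ι] [DecidableEq ι]
    (A : Distinguisher ι) (ρ : Op ι) : ℝ :=
  probOne A.out
    (circuitOp A.circuit * tensor ρ A.advice * (circuitOp A.circuit).conjTranspose)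

/-- A quantum algorithm with a one-bit output and oracle access to an `N`-qubit unitary, which
starts from an advice state (work qubits in the state `|0⟩` included). -/
structure OracleDistinguisher (N : ℕ) where
  work : ℕ
  advice : Op (Fin work)
  advice_isDensity : IsDensity advice
  circuit : List (Gate (Fin work) ⊕ (Fin N ↪ Fin work))
  out : Fin work

/-- The size of the algorithm: number of its qubits plus number of its gates and queries. -/
def OracleDistinguisher.size {N : ℕ} (A : OracleDistinguisher N) : ℕ :=
  A.work + A.circuit.length

/-- `Pr[A^U = 1]`. -/
noncomputable def OracleDistinguisher.prob {N : ℕ} (A : OracleDistinguisher N)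
    (U : UGroup (Fin N)) : ℝ :=
  probOne A.out
    (oracleCircuitOp U A.circuit * A.advice * (oracleCircuitOp U A.circuit).conjTranspose)

/-! Pseudorandom unitaries -/

/-- The families `{V n k}`, with keys `k ∈ {0,1}^{κ n}`, of unitaries on `N n` qubits are
pseudorandom unitaries: the key length is polynomial, `V n k |ψ⟩` can be computed from `k` and `|ψ⟩`
by circuits of polynomial size, and no polynomial-size quantum algorithm with oracle access
distinguishes `V n k`, for a uniformly random key `k`, from a Haar random unitary. -/
structure IsPRU (N κ : ℕ → ℕ) (V : ∀ n, Conf (Fin (κ n)) → UGroup (Fin (N n))) : Prop where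
  keyLength : PolyBounded κ
  efficient : ∃ (w : ℕ → ℕ) (C : ∀ n, List (Gate (Fin (N n) ⊕ (Fin (κ n) ⊕ Fin (w n))))),
    PolyBounded (fun n => N n + κ n + w n + (C n).length) ∧
    ∀ (n : ℕ) (k : Conf (Fin (κ n))) (ρ : Op (Fin (N n))), IsDensity ρ →
      traceRight (circuitOp (C n) * tensor ρ (tensor (basisState k) (zeroState (Fin (w n)))) *
        (circuitOp (C n)).conjTranspose) =
      (V n k : Op (Fin (N n))) * ρ * (V n k : Op (Fin (N n))).conjTranspose
  pseudorandom : ∀ A : ∀ n, OracleDistinguisher (N n), PolyBounded (fun n => (A n).size) →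
    Negligible fun n =>
      |uniformAvg (fun k => (A n).prob (V n k)) - ∫ U, (A n).prob U ∂haarU (Fin (N n))|

/-! The encryption channel -/

/-- The state `ρ ⊗ |0⟩⟨0| ⊗ σ` with `ℓ` tag qubits and `m` maximally mixed qubits. -/
noncomputable def padState {n : ℕ} (ℓ m : ℕ) (ρ : Op (Fin n)) : Op (Fin (n + ℓ + m)) :=
  relabel ((Equiv.sumCongr finSumFinEquiv (Equiv.refl (Fin m))).trans finSumFinEquiv)
    (tensor (tensor ρ (zeroState (Fin ℓ))) (maxMixed (Fin m)))

/-- The channel `Φ_U(ρ) = U (ρ ⊗ |0⟩⟨0| ⊗ σ) U†`. -/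
noncomputable def encrypt {n ℓ m : ℕ} (U : UGroup (Fin (n + ℓ + m))) :
    Op (Fin n) →ₗ[ℂ] Op (Fin (n + ℓ + m)) where
  toFun ρ := (U : Op (Fin (n + ℓ + m))) * padState ℓ m ρ *
    (U : Op (Fin (n + ℓ + m))).conjTranspose
  map_add' ρ τ := by
    have h : padState ℓ m (ρ + τ) = padState ℓ m ρ + padState ℓ m τ := by
      ext x y
      simp [padState, relabel, tensor, add_mul]
    rw [h, mul_add, add_mul]
  map_smul' c ρ := by
    have h : padState ℓ m (c • ρ) = c • padState ℓ m ρ := by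
      ext x y
      simp [padState, relabel, tensor, mul_assoc]
    rw [h, Matrix.mul_smul, Matrix.smul_mul, RingHom.id_apply]

/-- The scrambling unitary `U_k = V₁ V₂ V₃` of the key `k = (k₁, k₂, k₃)`. -/
def scrambler {κ₁ κ₂ κ₃ N : ℕ} (V₁ : Conf (Fin κ₁) → UGroup (Fin N))
    (V₂ : Conf (Fin κ₂) → UGroup (Fin N)) (V₃ : Conf (Fin κ₃) → UGroup (Fin N))
    (k : Conf (Fin κ₁) × Conf (Fin κ₂) × Conf (Fin κ₃)) : UGroup (Fin N) :=
  V₁ k.1 * V₂ k.2.1 * V₃ k.2.2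

/-- The Haar average `∫ (Φ_U^{⊗t} ⊗ id)(ρ) dU` (entrywise integral). -/
noncomputable def haarEncrypt {n t q : ℕ} (ℓ m : ℕ) (ρ : Op ((Fin t × Fin n) ⊕ (Fin t × Fin q))) :
    Op ((Fin t × Fin (n + ℓ + m)) ⊕ (Fin t × Fin q)) :=
  fun x y => ∫ U, parallel t (encrypt U) ρ x y ∂haarU (Fin (n + ℓ + m))

end QCrypto

open QCrypto

/-! Encryption applies the isometry `|a⟩ ↦ U|a, 0, s⟩` for a uniformly random `s` of `m` bits, so
`t` encryptions under the same `U` are an average over tuples `s₁, …, s_t`. When the `sⱼ` are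
distinct, the basis states fed into the `t` copies of `U` come from disjoint families. Flipping the
sign of a single basis state preserves the Haar measure, hence kills every off-diagonal term of the
twirl; permuting basis states also preserves it, hence makes all diagonal terms equal. So the twirl
sees only the reduced state on the other register, and it gives the same result when the message
and tag qubits are maximally mixed, where it is the ideal state. Tuples with a repetition have
probability at most `t² / 2^m`, and each side is a density matrix, so the trace distance is at most
`2 t² / 2^m`.

For security, fix the values of the remaining keys that favour the adversary the most, giving a
unitary `W`. An adversary against the encryption becomes an oracle algorithm that holds the state
encrypted under `W` as advice, queries its oracle once on each of the `t` blocks, and then runs the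
adversary. For a pseudorandom oracle this is the real experiment. For a Haar random oracle, right
invariance absorbs `W`, and the twirl bound applies. -/

namespace QCrypto

open MeasureTheory

theorem trace_mul_nonneg {α : Type*} [Fintype α] {A B : Matrix α α ℂ} (hA : A.PosSemidef)
    (hB : B.PosSemidef) : 0 ≤ (A * B).trace := by
  classical
  obtain ⟨C, rfl⟩ := CStarAlgebra.nonneg_iff_eq_star_mul_self.1 hA.nonneg
  rw [mul_assoc, Matrix.trace_mul_comm]
  exact (hB.mul_mul_conjTranspose_same C).trace_nonneg

theorem exists_abs_eq_mul {α : Type*} [Fintype α] [DecidableEq α] {A : Matrix α α ℂ}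
    (hA : IsSelfAdjoint A) : ∃ S : Matrix α α ℂ, -1 ≤ S ∧ S ≤ 1 ∧ CFC.abs A = S * A := by
  have hc (f : ℝ → ℝ) : ContinuousOn f (spectrum ℝ A) := A.finite_real_spectrum.continuousOn f
  have hsign (x : ℝ) : -1 ≤ (SignType.sign x : ℝ) ∧ (SignType.sign x : ℝ) ≤ 1 := by
    rcases lt_trichotomy x 0 with h | rfl | h <;> simp [*]
  refine ⟨cfc (fun x : ℝ => (SignType.sign x : ℝ)) A, ?_, cfc_le_one _ A fun x _ => (hsign x).2, ?_⟩
  · simpa using algebraMap_le_cfc _ (-1) A (fun x _ => (hsign x).1) (hc _)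
  · calc CFC.abs A = cfc (fun x : ℝ => SignType.sign x * x) A := by
          rw [CFC.abs_eq_cfc_norm A]
          exact cfc_congr fun x _ => (sign_mul_self x).symm
      _ = cfc (fun x : ℝ => (SignType.sign x : ℝ)) A * A := by
          rw [cfc_mul _ _ A (hc _) (hc _), cfc_id' ℝ A]

section TraceNorm

variable {ι : Type} [Fintype ι] [DecidableEq ι]

theorem traceNorm_sub_le {P Q : Op ι} (hP : P.PosSemidef) (hQ : Q.PosSemidef) :
    traceNorm (P - Q) ≤ P.trace.re + Q.trace.re := by
  obtain ⟨S, hS₁, hS₂, hS⟩ := exists_abs_eq_mul (hP.isHermitian.sub hQ.isHermitian)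
  have hSP : 0 ≤ P.trace - (S * P).trace := by
    simpa [sub_mul] using trace_mul_nonneg (Matrix.le_iff.1 hS₂) hP
  have hSQ : 0 ≤ (S * Q).trace + Q.trace := by
    simpa [add_mul] using trace_mul_nonneg (Matrix.le_iff.1 hS₁) hQ
  have habs : traceNorm (P - Q) = (S * P).trace.re - (S * Q).trace.re := by
    rw [← Complex.sub_re, ← Matrix.trace_sub, ← mul_sub, ← hS]
    rfl
  have hSP' := (Complex.le_def.1 hSP).1
  have hSQ' := (Complex.le_def.1 hSQ).1
  simp only [Complex.zero_re, Complex.sub_re, Complex.add_re] at hSP' hSQ'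
  linarith

theorem exists_posSemidef_sub_eq_and_traceNorm_eq {A : Op ι} (hA : A.IsHermitian) :
    ∃ P Q : Op ι, P.PosSemidef ∧ Q.PosSemidef ∧ P - Q = A ∧
      traceNorm A = P.trace.re + Q.trace.re := by
  refine ⟨A⁺, A⁻, Matrix.nonneg_iff_posSemidef.1 (CFC.posPart_nonneg A),
    Matrix.nonneg_iff_posSemidef.1 (CFC.negPart_nonneg A), CFC.posPart_sub_negPart A hA, ?_⟩
  rw [← Complex.add_re, ← Matrix.trace_add, CFC.posPart_add_negPart A hA]
  rfl

variable {S : Type*} [Fintype S]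

theorem isDensity_average [Nonempty S] {A : S → Op ι} (hA : ∀ s, IsDensity (A s)) :
    IsDensity ((Fintype.card S : ℂ)⁻¹ • ∑ s, A s) := by
  refine ⟨(Matrix.posSemidef_sum _ fun s _ => (hA s).1).smul (by positivity), ?_⟩
  rw [Matrix.trace_smul, Matrix.trace_sum]
  simp [(hA _).2]

theorem traceNorm_average_sub_average_le {A B : S → Op ι} (hA : ∀ s, IsDensity (A s))
    (hB : ∀ s, IsDensity (B s)) (p : S → Prop) [DecidablePred p] (hAB : ∀ s, ¬p s → A s = B s) :
    traceNorm ((Fintype.card S : ℂ)⁻¹ • ∑ s, A s - (Fintype.card S : ℂ)⁻¹ • ∑ s, B s) ≤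
      2 * ((Finset.univ.filter p).card / Fintype.card S) := by
  have hpos {C : S → Op ι} (hC : ∀ s, IsDensity (C s)) :
      ((Fintype.card S : ℂ)⁻¹ • ∑ s with p s, C s).PosSemidef :=
    (Matrix.posSemidef_sum _ fun s _ => (hC s).1).smul (by positivity)
  have htrace {C : S → Op ι} (hC : ∀ s, IsDensity (C s)) :
      ((Fintype.card S : ℂ)⁻¹ • ∑ s with p s, C s).trace.re =
        (Finset.univ.filter p).card / Fintype.card S := by
    rw [Matrix.trace_smul, Matrix.trace_sum, Finset.sum_congr rfl fun s _ => (hC s).2]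
    simp [← div_eq_inv_mul, -Complex.ofReal_natCast]
  have hsub : (Fintype.card S : ℂ)⁻¹ • ∑ s, A s - (Fintype.card S : ℂ)⁻¹ • ∑ s, B s =
      (Fintype.card S : ℂ)⁻¹ • ∑ s with p s, A s - (Fintype.card S : ℂ)⁻¹ • ∑ s with p s, B s := by
    simp only [← smul_sub, ← Finset.sum_sub_distrib]
    congr 1
    refine (Finset.sum_filter_of_ne fun s _ hs => ?_).symm
    exact not_not.1 fun hp => hs (sub_eq_zero.2 (hAB s hp))
  rw [hsub, two_mul]
  exact (traceNorm_sub_le (hpos hA) (hpos hB)).trans_eq (by rw [htrace hA, htrace hB])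

end TraceNorm

theorem card_not_injective_div_card_le (α : Type*) [Fintype α] [Nonempty α] [DecidableEq α]
    (t : ℕ) :
    ((Finset.univ.filter fun s : Fin t → α => ¬Function.Injective s).card : ℝ) /
      Fintype.card (Fin t → α) ≤ (t : ℝ) ^ 2 / Fintype.card α := by
  set N := Fintype.card α with hN
  have hN0 : (0 : ℝ) < N := by exact_mod_cast Fintype.card_pos
  have hcard : Fintype.card (Fin t → α) = N ^ t := by simp [hN]
  have hinj : (Finset.univ.filter fun s : Fin t → α => Function.Injective s).card =
      N.descFactorial t := by
    rw [← Fintype.card_subtype, Fintype.card_congr (Equiv.subtypeInjectiveEquivEmbedding _ _),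
      Fintype.card_embedding_eq, Fintype.card_fin]
  have hsum : (N.descFactorial t : ℝ) +
      (Finset.univ.filter fun s : Fin t → α => ¬Function.Injective s).card = (N : ℝ) ^ t := by
    rw [← hinj]
    exact_mod_cast (Finset.card_filter_add_card_filter_not _).trans hcard
  have hbernoulli : (1 - (t : ℝ) ^ 2 / N) * (N : ℝ) ^ t ≤ N.descFactorial t := by
    rcases lt_or_ge N t with hlt | hle
    · refine (mul_nonpos_of_nonpos_of_nonneg ?_ (by positivity)).trans (Nat.cast_nonneg _)
      have hlt' : (N : ℝ) + 1 ≤ t := by exact_mod_cast hlt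
      rw [sub_nonpos, one_le_div hN0]
      nlinarith
    · calc (1 - (t : ℝ) ^ 2 / N) * (N : ℝ) ^ t ≤ (1 + t * (-(t / N))) * (N : ℝ) ^ t := by
            gcongr; apply le_of_eq; ring
        _ ≤ (1 + -(t / N)) ^ t * (N : ℝ) ^ t := by
            gcongr
            refine one_add_mul_le_pow ?_ t
            have : (t : ℝ) / N ≤ 1 := div_le_one_of_le₀ (by exact_mod_cast hle) hN0.le
            linarith
        _ = ((N - t : ℕ) : ℝ) ^ t := by
            rw [← mul_pow, Nat.cast_sub hle]
            field_simp
            ring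
        _ ≤ N.descFactorial t := by
            exact_mod_cast
              (Nat.pow_le_pow_left (by omega) t).trans (Nat.pow_sub_le_descFactorial N t)
  rw [hcard, Nat.cast_pow, div_le_iff₀ (by positivity)]
  linarith

section Haar

variable {ι : Type} [Fintype ι] [DecidableEq ι]

instance isHaarMeasure_haarU : (haarU ι).IsHaarMeasure := by unfold haarU; infer_instance

instance isProbabilityMeasure_haarU : IsProbabilityMeasure (haarU ι) :=
  ⟨Measure.haarMeasure_self (K₀ := ⊤)⟩

instance isMulRightInvariant_haarU : (haarU ι).IsMulRightInvariant where
  map_mul_right_eq_self g := by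
    have := Measure.isProbabilityMeasure_map (μ := haarU ι) (measurable_mul_const g).aemeasurable
    have : ((haarU ι).map (· * g)).IsHaarMeasure := by infer_instance
    exact Measure.isHaarMeasure_eq_of_isProbabilityMeasure _ _

theorem integrable_haarU {E : Type*} [NormedAddCommGroup E] [SecondCountableTopology E]
    {f : UGroup ι → E} (hf : Continuous f) : Integrable f (haarU ι) := by
  borelize E
  exact hf.integrable_of_hasCompactSupport (HasCompactSupport.of_compactSpace f)

/-- The Haar average of a matrix-valued function, as the matrix of the averages of its entries. -/
noncomputable def haarMean {α : Type*} (F : UGroup ι → Matrix α α ℂ) : Matrix α α ℂ :=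
  fun x y => ∫ U, F U x y ∂haarU ι

section

open scoped Matrix.Norms.Elementwise

theorem haarMean_eq_integral {α : Type*} [Fintype α] {F : UGroup ι → Matrix α α ℂ}
    (hF : Continuous F) : haarMean F = ∫ U, F U ∂haarU ι := by
  ext x y
  exact (Matrix.entryLinearMap ℂ ℂ x y).toContinuousLinearMap.integral_comp_comm
    (integrable_haarU hF)

theorem integral_linearMap_comp {α : Type*} [Finite α] {F : UGroup ι → Matrix α α ℂ}
    {E : Type*} [NormedAddCommGroup E] [NormedSpace ℝ E] [FiniteDimensional ℝ E]
    (L : Matrix α α ℂ →ₗ[ℝ] E) (hF : Continuous F) :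
    ∫ U, L (F U) ∂haarU ι = L (haarMean F) := by
  have := FiniteDimensional.complete ℝ E
  have := Fintype.ofFinite α
  rw [haarMean_eq_integral hF]
  exact L.toContinuousLinearMap.integral_comp_comm (integrable_haarU hF)

end

theorem IsDensity.haarMean {κ : Type} [Fintype κ] [DecidableEq κ] {F : UGroup ι → Op κ}
    (hc : Continuous F) (hF : ∀ U, IsDensity (F U)) : IsDensity (haarMean F) := by
  refine ⟨Matrix.PosSemidef.of_dotProduct_mulVec_nonneg ?_ fun v => ?_, ?_⟩
  · ext x y
    exact integral_conj.symm.trans (integral_congr_ae (.of_forall fun U => (hF U).1.1.apply x y))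
  · let L : Op κ →ₗ[ℝ] ℂ :=
      { toFun := fun A => star v ⬝ᵥ A.mulVec v
        map_add' := fun A B => by rw [Matrix.add_mulVec, dotProduct_add]
        map_smul' := fun c A => by rw [Matrix.smul_mulVec, dotProduct_smul, RingHom.id_apply] }
    exact (integral_nonneg fun U => (hF U).1.dotProduct_mulVec_nonneg v).trans_eq
      (integral_linearMap_comp L hc)
  · let L : Op κ →ₗ[ℝ] ℂ := (Matrix.traceLinearMap (Conf κ) ℂ ℂ).restrictScalars ℝ
    exact (integral_linearMap_comp L hc).symm.trans (by simp [L, (hF _).2])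

/-- The moment `∫ ∏ⱼ U_{xⱼ uⱼ} conj(U_{yⱼ vⱼ}) dU`, that is, an entry of the Haar twirl of
`|u⟩⟨v|`. -/
noncomputable def haarMoment {t : ℕ} (x y u v : Fin t → Conf ι) : ℂ :=
  ∫ U, ∏ j, ((U : Op ι) (x j) (u j) * star ((U : Op ι) (y j) (v j))) ∂haarU ι

theorem haarMoment_eq_of_right_mul {t : ℕ} (x y u v : Fin t → Conf ι) (W : UGroup ι) :
    haarMoment x y u v = ∫ U, ∏ j, (((U : Op ι) * (W : Op ι)) (x j) (u j) *
      star (((U : Op ι) * (W : Op ι)) (y j) (v j))) ∂haarU ι :=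
  (integral_mul_right_eq_self (μ := haarU ι)
    (fun U : UGroup ι => ∏ j, ((U : Op ι) (x j) (u j) * star ((U : Op ι) (y j) (v j)))) W).symm

/-- The diagonal unitary that flips the sign of the basis state `|b⟩`. -/
noncomputable def signFlip (b : Conf ι) : UGroup ι :=
  ⟨Matrix.diagonal fun x => if x = b then -1 else 1, by
    rw [Matrix.mem_unitaryGroup_iff, Matrix.star_eq_conjTranspose, Matrix.diagonal_conjTranspose,
      Matrix.diagonal_mul_diagonal, ← Matrix.diagonal_one]
    congr 1
    ext x
    by_cases h : x = b <;> simp [h]⟩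

/-- The permutation matrix that maps each basis state `|a⟩` to `|σ a⟩`. -/
noncomputable def permUnitary (σ : Equiv.Perm (Conf ι)) : UGroup ι :=
  ⟨(1 : Op ι).submatrix id σ, by
    rw [Matrix.mem_unitaryGroup_iff', Matrix.star_eq_conjTranspose, Matrix.conjTranspose_submatrix,
      Matrix.conjTranspose_one, ← Matrix.submatrix_mul _ _ _ id _ Function.bijective_id,
      Matrix.one_mul, Matrix.submatrix_one_equiv]⟩

theorem haarMoment_eq_zero {t : ℕ} (x y u v : Fin t → Conf ι) (j : Fin t)
    (hu : ∀ i, u i = u j → i = j) (hv : ∀ i, v i ≠ u j) : haarMoment x y u v = 0 := by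
  -- Right multiplication by the sign flip of `u j`, a label that occurs only once, negates the
  -- moment.
  refine self_eq_neg.1 ?_
  rw [haarMoment, ← integral_neg, ← haarMoment,
    haarMoment_eq_of_right_mul x y u v (signFlip (u j))]
  congr 1 with U
  have hfactor (i : Fin t) : ((U : Op ι) * (signFlip (u j) : Op ι)) (x i) (u i) *
      star (((U : Op ι) * (signFlip (u j) : Op ι)) (y i) (v i)) =
      (if i = j then -1 else 1) * ((U : Op ι) (x i) (u i) * star ((U : Op ι) (y i) (v i))) := by
    have hij : u i = u j ↔ i = j := ⟨hu i, congrArg u⟩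
    simp [signFlip, Matrix.mul_diagonal, hv i, hij, mul_comm]
  rw [Finset.prod_congr rfl fun i _ => hfactor i, Finset.prod_mul_distrib]
  simp

theorem haarMoment_comp_perm {t : ℕ} (x y u v : Fin t → Conf ι) (σ : Equiv.Perm (Conf ι)) :
    haarMoment x y (σ ∘ u) (σ ∘ v) = haarMoment x y u v := by
  rw [haarMoment_eq_of_right_mul x y u v (permUnitary σ)]
  simp [haarMoment, permUnitary, Matrix.mul_apply, Matrix.one_apply]

theorem haarMoment_eq_of_injective {t : ℕ} (x y : Fin t → Conf ι) {u v : Fin t → Conf ι}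
    (hu : Function.Injective u) (hv : Function.Injective v) :
    haarMoment x y u u = haarMoment x y v v := by
  classical
  let e : Set.range u ≃ Set.range v :=
    (Equiv.ofInjective u hu).symm.trans (Equiv.ofInjective v hv)
  have h : (e.extendSubtype : Conf ι → Conf ι) ∘ u = v := by
    ext1 j
    rw [Function.comp_apply, e.extendSubtype_apply_of_mem _ ⟨j, rfl⟩]
    simp [e, Equiv.ofInjective_symm_apply]
  rw [← h, haarMoment_comp_perm]

end Haar

theorem trace_submatrix_equiv {α β : Type*} [Fintype α] [Fintype β] (A : Matrix α α ℂ)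
    (e : β ≃ α) : (A.submatrix e e).trace = A.trace :=
  e.sum_comp fun i => A i i

section TensorProduct

variable {ι κ : Type}

theorem tensor_eq_submatrix_kronecker (A : Op ι) (B : Op κ) :
    tensor A B = (Matrix.kroneckerMap (· * ·) A B).submatrix
      (Equiv.sumArrowEquivProdArrow ι κ Bool) (Equiv.sumArrowEquivProdArrow ι κ Bool) := rfl

theorem relabel_eq_submatrix (e : ι ≃ κ) (A : Op ι) :
    relabel e A = A.submatrix (e.symm.arrowCongr (Equiv.refl Bool))
      (e.symm.arrowCongr (Equiv.refl Bool)) := rfl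

theorem relabel_sumEmpty_symm (A : Op ι) :
    relabel (Equiv.sumEmpty ι Empty).symm A = tensor A 1 := by
  ext x y
  rw [tensor, Subsingleton.elim (x ∘ Sum.inr) (y ∘ Sum.inr), Matrix.one_apply_eq, mul_one]
  rfl

theorem posSemidef_tensor [Finite ι] [Finite κ] {A : Op ι} {B : Op κ} (hA : A.PosSemidef)
    (hB : B.PosSemidef) : (tensor A B).PosSemidef := by
  rw [tensor_eq_submatrix_kronecker]
  exact (hA.kronecker hB).submatrix _

variable [Fintype ι]

theorem relabel_one [Fintype κ] (e : ι ≃ κ) : relabel e (1 : Op ι) = 1 := by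
  rw [relabel_eq_submatrix, Matrix.submatrix_one_equiv]

variable [DecidableEq ι]

theorem traceLeft_tensor (A : Op ι) (B : Op κ) : traceLeft (tensor A B) = A.trace • B := by
  ext x y
  exact (Finset.sum_mul _ (fun a => A a a) (B x y)).symm

theorem isDensity_maxMixed : IsDensity (maxMixed ι) := by
  refine ⟨Matrix.PosSemidef.one.smul (by positivity), ?_⟩
  simp [maxMixed]

variable [Fintype κ] [DecidableEq κ]

theorem tensor_mul_tensor (A A' : Op ι) (B B' : Op κ) :
    tensor A B * tensor A' B' = tensor (A * A') (B * B') := by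
  simp only [tensor_eq_submatrix_kronecker, Matrix.submatrix_mul_equiv, Matrix.mul_kronecker_mul]

theorem trace_tensor (A : Op ι) (B : Op κ) : (tensor A B).trace = A.trace * B.trace := by
  rw [tensor_eq_submatrix_kronecker, trace_submatrix_equiv, Matrix.trace_kronecker]

theorem IsDensity.tensor {A : Op ι} {B : Op κ} (hA : IsDensity A) (hB : IsDensity B) :
    IsDensity (QCrypto.tensor A B) :=
  ⟨posSemidef_tensor hA.1 hB.1, by rw [trace_tensor, hA.2, hB.2, mul_one]⟩

theorem relabel_mul (e : ι ≃ κ) (A B : Op ι) : relabel e (A * B) = relabel e A * relabel e B := by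
  simp only [relabel_eq_submatrix, Matrix.submatrix_mul_equiv]

theorem IsDensity.relabel (e : ι ≃ κ) {A : Op ι} (hA : IsDensity A) :
    IsDensity (QCrypto.relabel e A) :=
  ⟨hA.1.submatrix _, by rw [relabel_eq_submatrix, trace_submatrix_equiv, hA.2]⟩

theorem IsDensity.traceLeft {ρ : Op (ι ⊕ κ)} (hρ : IsDensity ρ) :
    IsDensity (QCrypto.traceLeft ρ) := by
  constructor
  · have h : QCrypto.traceLeft ρ = ∑ a : Conf ι, ρ.submatrix (Sum.elim a) (Sum.elim a) := by
      ext x y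
      simp [QCrypto.traceLeft, Matrix.sum_apply]
    exact h ▸ Matrix.posSemidef_sum _ fun a _ => hρ.1.submatrix _
  · rw [← hρ.2, ← trace_submatrix_equiv ρ (Equiv.sumArrowEquivProdArrow ι κ Bool).symm,
      Matrix.trace, Matrix.trace, Fintype.sum_prod_type_right]
    rfl

end TensorProduct

section Conjugation

variable {ι ι₀ ι₁ : Type} [Fintype ι₀] [DecidableEq ι₀]

/-- The completely positive map `X ↦ K X K†`. The operator `K` may map between different
registers. -/
noncomputable def conjBy (K : Matrix (Conf ι) (Conf ι₀) ℂ) : Op ι₀ →ₗ[ℂ] Op ι where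
  toFun X := K * X * K.conjTranspose
  map_add' X Y := by rw [Matrix.mul_add, Matrix.add_mul]
  map_smul' c X := by rw [Matrix.mul_smul, Matrix.smul_mul, RingHom.id_apply]

theorem conjBy_apply (K : Matrix (Conf ι) (Conf ι₀) ℂ) (X : Op ι₀) :
    conjBy K X = K * X * K.conjTranspose := rfl

theorem conjBy_apply_apply (K : Matrix (Conf ι) (Conf ι₀) ℂ) (X : Op ι₀) (x y : Conf ι) :
    conjBy K X x y = ∑ a, ∑ b, K x a * star (K y b) * X a b := by
  simp only [conjBy_apply, Matrix.mul_apply, Matrix.conjTranspose_apply, Finset.sum_mul]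
  rw [Finset.sum_comm]
  exact Finset.sum_congr rfl fun a _ => Finset.sum_congr rfl fun b _ => mul_right_comm ..

theorem conjBy_single_apply (K : Matrix (Conf ι) (Conf ι₀) ℂ) (a b : Conf ι₀) (x y : Conf ι) :
    conjBy K (Matrix.single a b 1) x y = K x a * star (K y b) := by
  rw [conjBy_apply_apply, Finset.sum_eq_single a, Finset.sum_eq_single b] <;>
    simp +contextual [Matrix.single_apply, eq_comm]

variable [Fintype ι] [DecidableEq ι]

theorem conjBy_mul (K : Matrix (Conf ι₁) (Conf ι) ℂ) (K' : Matrix (Conf ι) (Conf ι₀) ℂ) :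
    conjBy (K * K') = conjBy K ∘ₗ conjBy K' := by
  ext1 X
  simp only [LinearMap.comp_apply, conjBy_apply, Matrix.conjTranspose_mul, Matrix.mul_assoc]

theorem relabel_conjBy (e : ι ≃ ι₀) (K X : Op ι) :
    relabel e (conjBy K X) = conjBy (relabel e K) (relabel e X) := by
  rw [conjBy_apply, relabel_mul, relabel_mul]
  rfl

theorem IsDensity.conjBy {K : Matrix (Conf ι) (Conf ι₀) ℂ} (hK : K.conjTranspose * K = 1)
    {ρ : Op ι₀} (hρ : IsDensity ρ) : IsDensity (QCrypto.conjBy K ρ) :=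
  ⟨hρ.1.mul_mul_conjTranspose_same K, by
    rw [conjBy_apply, Matrix.trace_mul_cycle, hK, Matrix.one_mul, hρ.2]⟩

end Conjugation

section TensorFam

variable {ι ι₀ ι₁ : Type} {t : ℕ}

/-- The tensor product of `t` operators between two registers, with the labels `(j, i)` of
`tensorPow`. -/
noncomputable def tensorFam (K : Fin t → Matrix (Conf ι) (Conf ι₀) ℂ) :
    Matrix (Conf (Fin t × ι)) (Conf (Fin t × ι₀)) ℂ :=
  fun x y => ∏ j, K j (fun i => x (j, i)) (fun i => y (j, i))

theorem tensorPow_eq_tensorFam (A : Op ι) : tensorPow t A = tensorFam fun _ => A := rfl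

theorem conjTranspose_tensorFam (K : Fin t → Matrix (Conf ι) (Conf ι₀) ℂ) :
    (tensorFam K).conjTranspose = tensorFam fun j => (K j).conjTranspose := by
  ext x y
  simp [tensorFam]

theorem tensorFam_one [Fintype ι] : tensorFam (fun _ : Fin t => (1 : Op ι)) = 1 := by
  ext x y
  simp only [tensorFam, Matrix.one_apply, Finset.prod_ite_zero, Finset.prod_const_one,
    Finset.mem_univ, true_imp_iff]
  congr 1
  simp only [funext_iff, Prod.forall]

variable [Fintype ι] [DecidableEq ι]

theorem tensorFam_mul (K : Fin t → Matrix (Conf ι₁) (Conf ι) ℂ)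
    (K' : Fin t → Matrix (Conf ι) (Conf ι₀) ℂ) :
    tensorFam (fun j => K j * K' j) = tensorFam K * tensorFam K' := by
  ext x y
  simp only [tensorFam, Matrix.mul_apply]
  rw [Finset.prod_univ_sum, Fintype.piFinset_univ, ← (Equiv.curry (Fin t) ι Bool).sum_comp]
  simp only [Finset.prod_mul_distrib]
  rfl

theorem trace_tensorPow (A : Op ι) : (tensorPow t A).trace = A.trace ^ t := by
  simp only [Matrix.trace, Matrix.diag_apply, tensorPow]
  rw [← Fin.prod_const, Finset.prod_univ_sum, Fintype.piFinset_univ,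
    ← (Equiv.curry (Fin t) ι Bool).sum_comp]
  rfl

theorem IsDensity.tensorPow {A : Op ι} (hA : IsDensity A) :
    IsDensity (QCrypto.tensorPow t A) := by
  refine ⟨?_, by rw [trace_tensorPow, hA.2, one_pow]⟩
  obtain ⟨B, rfl⟩ := CStarAlgebra.nonneg_iff_eq_star_mul_self.1 hA.1.nonneg
  rw [tensorPow_eq_tensorFam, tensorFam_mul, Matrix.star_eq_conjTranspose,
    ← conjTranspose_tensorFam]
  exact Matrix.posSemidef_conjTranspose_mul_self _

end TensorFam

section Ampliate

variable {ι ι₀ ι₁ κ : Type} [Fintype κ]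

/-- The operator `K ⊗ 1` for an operator `K` between two registers and a register `κ` on which it
does not act. -/
noncomputable def ampliate (κ : Type) [Fintype κ] (K : Matrix (Conf ι) (Conf ι₀) ℂ) :
    Matrix (Conf (ι ⊕ κ)) (Conf (ι₀ ⊕ κ)) ℂ :=
  fun x y => K (x ∘ Sum.inl) (y ∘ Sum.inl) * (1 : Op κ) (x ∘ Sum.inr) (y ∘ Sum.inr)

theorem tensor_one_eq_ampliate (A : Op ι) : tensor A (1 : Op κ) = ampliate κ A := rfl

theorem ampliate_eq_submatrix_kronecker (K : Matrix (Conf ι) (Conf ι₀) ℂ) :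
    ampliate κ K = (Matrix.kroneckerMap (· * ·) K (1 : Op κ)).submatrix
      (Equiv.sumArrowEquivProdArrow ι κ Bool) (Equiv.sumArrowEquivProdArrow ι₀ κ Bool) := rfl

theorem conjTranspose_ampliate (K : Matrix (Conf ι) (Conf ι₀) ℂ) :
    (ampliate κ K).conjTranspose = ampliate κ K.conjTranspose := by
  simp only [ampliate_eq_submatrix_kronecker, Matrix.conjTranspose_submatrix,
    Matrix.conjTranspose_kronecker, Matrix.conjTranspose_one]

variable [Fintype ι]

theorem ampliate_one : ampliate κ (1 : Op ι) = 1 := by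
  rw [ampliate_eq_submatrix_kronecker,
    Matrix.kroneckerMap_one_one _ zero_mul mul_zero (mul_one 1), Matrix.submatrix_one_equiv]

variable [DecidableEq ι] [DecidableEq κ]

theorem ampliate_mul (K : Matrix (Conf ι₁) (Conf ι) ℂ) (K' : Matrix (Conf ι) (Conf ι₀) ℂ) :
    ampliate κ (K * K') = ampliate κ K * ampliate κ K' := by
  simp only [ampliate_eq_submatrix_kronecker, Matrix.submatrix_mul_equiv,
    ← Matrix.mul_kronecker_mul, mul_one]

theorem conjBy_ampliate_tensor (U A : Op ι) (B : Op κ) :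
    conjBy (ampliate κ U) (tensor A B) = tensor (conjBy U A) B := by
  rw [conjBy_apply, conjTranspose_ampliate, ← tensor_one_eq_ampliate, ← tensor_one_eq_ampliate,
    tensor_mul_tensor, tensor_mul_tensor, one_mul, mul_one, conjBy_apply]

theorem conjBy_ampliate_apply (K : Matrix (Conf ι₀) (Conf ι) ℂ) (ρ : Op (ι ⊕ κ))
    (x y : Conf (ι₀ ⊕ κ)) :
    conjBy (ampliate κ K) ρ x y = ∑ a, ∑ b, K (x ∘ Sum.inl) a * star (K (y ∘ Sum.inl) b) *
      ρ (Sum.elim a (x ∘ Sum.inr)) (Sum.elim b (y ∘ Sum.inr)) := by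
  have hsum (f : Conf (ι ⊕ κ) → ℂ) : ∑ a, f a = ∑ a, ∑ c, f (Sum.elim a c) := by
    rw [← (Equiv.sumArrowEquivProdArrow ι κ Bool).symm.sum_comp, Fintype.sum_prod_type]
    rfl
  have hentry (z : Conf (ι₀ ⊕ κ)) (a : Conf ι) (c : Conf κ) : ampliate κ K z (Sum.elim a c) =
    K (z ∘ Sum.inl) a * (1 : Op κ) (z ∘ Sum.inr) c := rfl
  simp [conjBy_apply_apply, hsum, hentry, Matrix.one_apply, apply_ite (starRingEnd ℂ)]

theorem conjBy_ampliate_tensorFam_apply {t : ℕ} (K : Fin t → Matrix (Conf ι₀) (Conf ι) ℂ)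
    (ρ : Op ((Fin t × ι) ⊕ κ)) (x y : Conf ((Fin t × ι₀) ⊕ κ)) :
    conjBy (ampliate κ (tensorFam K)) ρ x y = ∑ a : Fin t → Conf ι, ∑ b : Fin t → Conf ι,
      (∏ j, K j (fun i => x (Sum.inl (j, i))) (a j) *
          star (K j (fun i => y (Sum.inl (j, i))) (b j))) *
        ρ (Sum.elim (fun p => a p.1 p.2) (x ∘ Sum.inr))
          (Sum.elim (fun p => b p.1 p.2) (y ∘ Sum.inr)) := by
  rw [conjBy_ampliate_apply, ← (Equiv.curry (Fin t) ι Bool).symm.sum_comp]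
  refine Finset.sum_congr rfl fun a _ => ?_
  rw [← (Equiv.curry (Fin t) ι Bool).symm.sum_comp]
  refine Finset.sum_congr rfl fun b _ => ?_
  simp only [tensorFam, star_prod, Finset.prod_mul_distrib]
  rfl

end Ampliate

section Parallel

variable {ι ι₀ ι₁ κ : Type} [Fintype ι₀] [DecidableEq ι₀] {t : ℕ}

theorem parallel_tensor_tensorPow (Φ : Op ι₀ →ₗ[ℂ] Op ι) (ρ : Op ι₀) (τ : Op κ) :
    parallel t Φ (tensor (tensorPow t ρ) τ) = tensor (tensorPow t (Φ ρ)) τ := by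
  have hΦ (x y : Conf ι) : Φ ρ x y = ∑ a, ∑ b, Φ (Matrix.single a b 1) x y * ρ a b := by
    conv_lhs => rw [Matrix.matrix_eq_sum_single ρ]
    simp only [map_sum, Matrix.sum_apply]
    refine Finset.sum_congr rfl fun a _ => Finset.sum_congr rfl fun b _ => ?_
    rw [← mul_one (ρ a b), ← smul_eq_mul, ← Matrix.smul_single, map_smul, Matrix.smul_apply,
      smul_eq_mul, smul_eq_mul, mul_one, mul_comm]
  ext x y
  simp only [parallel, tensor, tensorPow, hΦ, Finset.prod_univ_sum, Fintype.piFinset_univ,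
    Finset.sum_mul, Finset.prod_mul_distrib, mul_assoc]
  rfl

theorem parallel_conjBy_comp [Fintype ι] [DecidableEq ι] [Fintype κ] [DecidableEq κ]
    (L : Matrix (Conf ι₁) (Conf ι) ℂ) (Φ : Op ι₀ →ₗ[ℂ] Op ι) (ρ : Op ((Fin t × ι₀) ⊕ κ)) :
    parallel t (conjBy L ∘ₗ Φ) ρ =
      conjBy (ampliate κ (tensorFam fun _ => L)) (parallel t Φ ρ) := by
  have hcomm {X Y : Type} [Fintype X] [Fintype Y] (f : X → X → Y → Y → ℂ) :
      ∑ a, ∑ b, ∑ c, ∑ d, f a b c d = ∑ c, ∑ d, ∑ a, ∑ b, f a b c d := by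
    simpa only [Fintype.sum_prod_type] using
      Finset.sum_comm (s := Finset.univ) (t := Finset.univ)
        (f := fun (p : X × X) (q : Y × Y) => f p.1 p.2 q.1 q.2)
  ext x y
  rw [conjBy_ampliate_tensorFam_apply]
  simp only [parallel, LinearMap.comp_apply, conjBy_apply_apply, Finset.prod_univ_sum,
    Fintype.piFinset_univ, Finset.sum_mul, Finset.mul_sum, Finset.prod_mul_distrib, mul_assoc]
  exact hcomm _

variable {S : Type*} [Fintype S]

/-- The channel that conjugates by `K s` for a uniformly random `s`. -/
noncomputable def avgConjBy (K : S → Matrix (Conf ι) (Conf ι₀) ℂ) : Op ι₀ →ₗ[ℂ] Op ι :=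
  (Fintype.card S : ℂ)⁻¹ • ∑ s, conjBy (K s)

theorem avgConjBy_apply (K : S → Matrix (Conf ι) (Conf ι₀) ℂ) (X : Op ι₀) :
    avgConjBy K X = (Fintype.card S : ℂ)⁻¹ • ∑ s, conjBy (K s) X := by
  rw [avgConjBy, LinearMap.smul_apply, LinearMap.sum_apply]

theorem parallel_avgConjBy [Fintype κ] [DecidableEq κ] (K : S → Matrix (Conf ι) (Conf ι₀) ℂ)
    (ρ : Op ((Fin t × ι₀) ⊕ κ)) :
    parallel t (avgConjBy K) ρ =
      avgConjBy (fun s : Fin t → S => ampliate κ (tensorFam fun j => K (s j))) ρ := by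
  ext x y
  simp only [parallel, avgConjBy_apply, Matrix.smul_apply, Matrix.sum_apply, smul_eq_mul,
    conjBy_single_apply, conjBy_ampliate_tensorFam_apply, Finset.prod_mul_distrib,
    Finset.prod_univ_sum, Fintype.piFinset_univ, Finset.prod_const, Finset.card_univ,
    Fintype.card_fin, Fintype.card_fun, Nat.cast_pow, inv_pow, mul_assoc, Finset.sum_mul,
    Finset.mul_sum]
  exact (Finset.sum_congr rfl fun a _ => Finset.sum_comm).trans Finset.sum_comm

theorem IsDensity.avgConjBy [Fintype ι] [DecidableEq ι] [Nonempty S]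
    {K : S → Matrix (Conf ι) (Conf ι₀) ℂ} (hK : ∀ s, (K s).conjTranspose * K s = 1) {ρ : Op ι₀}
    (hρ : IsDensity ρ) : IsDensity (QCrypto.avgConjBy K ρ) := by
  rw [avgConjBy_apply]
  exact isDensity_average fun s => hρ.conjBy (hK s)

end Parallel

section BasisEmb

variable {ι ι₀ κ : Type} [Fintype ι] {t : ℕ}

theorem conjTranspose_mul_ampliate_tensorFam [Fintype ι₀] [DecidableEq ι] [Fintype κ]
    [DecidableEq κ] {K : Fin t → Matrix (Conf ι) (Conf ι₀) ℂ}
    (hK : ∀ j, (K j).conjTranspose * K j = 1) :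
    (ampliate κ (tensorFam K)).conjTranspose * ampliate κ (tensorFam K) = 1 := by
  rw [conjTranspose_ampliate, ← ampliate_mul, conjTranspose_tensorFam, ← tensorFam_mul]
  simp only [hK, tensorFam_one, ampliate_one]

theorem IsDensity.parallel_avgConjBy [Fintype ι₀] [DecidableEq ι₀] [DecidableEq ι] [Fintype κ]
    [DecidableEq κ] {S : Type*} [Fintype S] [Nonempty S] {K : S → Matrix (Conf ι) (Conf ι₀) ℂ}
    (hK : ∀ s, (K s).conjTranspose * K s = 1) {ρ : Op ((Fin t × ι₀) ⊕ κ)} (hρ : IsDensity ρ) :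
    IsDensity (parallel t (QCrypto.avgConjBy K) ρ) := by
  rw [QCrypto.parallel_avgConjBy]
  refine hρ.avgConjBy fun s => ?_
  exact conjTranspose_mul_ampliate_tensorFam fun j => hK (s j)

/-- The linear map between two registers that sends the basis state `|a⟩` to `|w a⟩`, an isometry
when `w` is injective. -/
noncomputable def basisEmb (w : Conf ι₀ → Conf ι) : Matrix (Conf ι) (Conf ι₀) ℂ :=
  (1 : Op ι).submatrix id w

variable [DecidableEq ι]

theorem conjTranspose_mul_basisEmb [Fintype ι₀] {w : Conf ι₀ → Conf ι}
    (hw : Function.Injective w) : (basisEmb w).conjTranspose * basisEmb w = 1 := by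
  rw [basisEmb, Matrix.conjTranspose_submatrix, Matrix.conjTranspose_one,
    ← Matrix.submatrix_mul _ _ _ id _ Function.bijective_id, mul_one, Matrix.submatrix_one _ hw]

theorem mul_basisEmb (A : Op ι) (w : Conf ι₀ → Conf ι) : A * basisEmb w = A.submatrix id w := by
  rw [basisEmb, ← Matrix.submatrix_id_id A, ← Matrix.submatrix_mul _ _ _ id _ Function.bijective_id,
    Matrix.submatrix_id_id, mul_one]

theorem avgConjBy_basisEmb_maxMixed [Fintype ι₀] [DecidableEq ι₀] {S : Type*} [Fintype S]
    {v : S → Conf ι₀ → Conf ι} (hv : Function.Bijective (Function.uncurry v)) :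
    avgConjBy (fun s => basisEmb (v s)) (maxMixed ι₀) = maxMixed ι := by
  have hcard : (2 : ℂ) ^ Fintype.card ι₀ * Fintype.card S = 2 ^ Fintype.card ι := by
    have := Fintype.card_of_bijective hv
    simp only [Fintype.card_prod, Fintype.card_fun, Fintype.card_bool] at this
    rw [mul_comm]
    exact_mod_cast this
  have hsum : ∑ s, conjBy (basisEmb (v s)) 1 = 1 := by
    ext x y
    calc (∑ s, conjBy (basisEmb (v s)) 1) x y
        = ∑ p : S × Conf ι₀, (1 : Op ι) x (v p.1 p.2) * (1 : Op ι) (v p.1 p.2) y := by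
          rw [Matrix.sum_apply, Fintype.sum_prod_type]
          refine Finset.sum_congr rfl fun s _ => ?_
          rw [conjBy_apply, Matrix.mul_one, basisEmb, Matrix.conjTranspose_submatrix,
            Matrix.conjTranspose_one, Matrix.mul_apply]
          rfl
      _ = ∑ z, (1 : Op ι) x z * (1 : Op ι) z y :=
          (Equiv.ofBijective _ hv).sum_comp fun z => (1 : Op ι) x z * (1 : Op ι) z y
      _ = (1 : Op ι) x y := by rw [← Matrix.mul_apply, mul_one]
  simp only [avgConjBy_apply, maxMixed, map_smul]
  rw [hsum, smul_smul, ← mul_inv, hcard]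

end BasisEmb

section HaarTwirl

variable {ι ι₀ ι₁ κ : Type} [Fintype ι] [DecidableEq ι] [Fintype κ] [DecidableEq κ] {t : ℕ}

theorem continuous_conjBy_ampliate_tensorPow (ρ : Op ((Fin t × ι) ⊕ κ)) :
    Continuous fun U : UGroup ι => conjBy (ampliate κ (tensorPow t (U : Op ι))) ρ := by
  have h (x y : Conf ((Fin t × ι) ⊕ κ)) :
      Continuous fun U : UGroup ι => ampliate κ (tensorPow t (U : Op ι)) x y := by
    refine (continuous_finsetProd _ fun j _ => ?_).mul continuous_const
    exact continuous_subtype_val.matrix_elem _ _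
  have h' : Continuous fun U : UGroup ι => ampliate κ (tensorPow t (U : Op ι)) :=
    continuous_matrix h
  exact (h'.matrix_mul continuous_const).matrix_mul h'.matrix_conjTranspose

theorem IsDensity.conjBy_ampliate_tensorPow {ρ : Op ((Fin t × ι) ⊕ κ)} (hρ : IsDensity ρ)
    (U : UGroup ι) : IsDensity (QCrypto.conjBy (ampliate κ (QCrypto.tensorPow t (U : Op ι))) ρ) :=
  hρ.conjBy (conjTranspose_mul_ampliate_tensorFam fun _ => Unitary.coe_star_mul_self U)

/-- The twirling channel `ρ ↦ ∫ (U^{⊗t} ⊗ 1) ρ (U^{⊗t} ⊗ 1)† dU`. -/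
noncomputable def haarTwirl : Op ((Fin t × ι) ⊕ κ) →ₗ[ℂ] Op ((Fin t × ι) ⊕ κ) where
  toFun ρ := haarMean fun U : UGroup ι => conjBy (ampliate κ (tensorPow t (U : Op ι))) ρ
  map_add' ρ τ := by
    ext x y
    simp only [map_add]
    exact integral_add (integrable_haarU ((continuous_conjBy_ampliate_tensorPow ρ).matrix_elem x y))
      (integrable_haarU ((continuous_conjBy_ampliate_tensorPow τ).matrix_elem x y))
  map_smul' c ρ := by
    ext x y
    simp only [map_smul]
    exact integral_const_mul c _

theorem haarTwirl_apply (ρ : Op ((Fin t × ι) ⊕ κ)) : haarTwirl ρ =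
    haarMean fun U : UGroup ι => conjBy (ampliate κ (tensorPow t (U : Op ι))) ρ := rfl

theorem IsDensity.haarTwirl {ρ : Op ((Fin t × ι) ⊕ κ)} (hρ : IsDensity ρ) :
    IsDensity (QCrypto.haarTwirl ρ) :=
  .haarMean (continuous_conjBy_ampliate_tensorPow ρ) hρ.conjBy_ampliate_tensorPow

theorem haarTwirl_tensorPow_maxMixed (τ : Op κ) :
    haarTwirl (tensor (tensorPow t (maxMixed ι)) τ) = tensor (tensorPow t (maxMixed ι)) τ := by
  have h (U : UGroup ι) : conjBy (ampliate κ (tensorPow t (U : Op ι)))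
      (tensor (tensorPow t (maxMixed ι)) τ) = tensor (tensorPow t (maxMixed ι)) τ := by
    have hU : (U : Op ι) * maxMixed ι * (U : Op ι).conjTranspose = maxMixed ι := by
      rw [maxMixed, Matrix.mul_smul, mul_one, Matrix.smul_mul]
      exact congrArg _ (Unitary.coe_mul_star_self U)
    rw [conjBy_ampliate_tensor, conjBy_apply]
    simp only [tensorPow_eq_tensorFam, conjTranspose_tensorFam, ← tensorFam_mul, hU]
  ext x y
  simp only [haarTwirl_apply, h, haarMean, integral_const, probReal_univ, one_smul]

variable [Fintype ι₀] [DecidableEq ι₀] [Fintype ι₁] [DecidableEq ι₁]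

theorem haarTwirl_conjBy_basisEmb_apply (w : Fin t → Conf ι₀ → Conf ι)
    (ρ : Op ((Fin t × ι₀) ⊕ κ)) (x y : Conf ((Fin t × ι) ⊕ κ)) :
    haarTwirl (conjBy (ampliate κ (tensorFam fun j => basisEmb (w j))) ρ) x y =
      ∑ a : Fin t → Conf ι₀, ∑ b : Fin t → Conf ι₀,
        haarMoment (fun j i => x (Sum.inl (j, i))) (fun j i => y (Sum.inl (j, i)))
          (fun j => w j (a j)) (fun j => w j (b j)) *
        ρ (Sum.elim (fun p => a p.1 p.2) (x ∘ Sum.inr))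
          (Sum.elim (fun p => b p.1 p.2) (y ∘ Sum.inr)) := by
  have hU (U : UGroup ι) : conjBy (ampliate κ (tensorPow t (U : Op ι)))
      (conjBy (ampliate κ (tensorFam fun j => basisEmb (w j))) ρ) =
      conjBy (ampliate κ (tensorFam fun j => (U : Op ι).submatrix id (w j))) ρ := by
    rw [← LinearMap.comp_apply, ← conjBy_mul, ← ampliate_mul, tensorPow_eq_tensorFam,
      ← tensorFam_mul]
    simp only [mul_basisEmb]
  simp only [haarTwirl_apply, hU, haarMean, conjBy_ampliate_tensorFam_apply]
  rw [integral_finsetSum _ fun a _ => integrable_haarU (by fun_prop)]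
  refine Finset.sum_congr rfl fun a _ => ?_
  rw [integral_finsetSum _ fun b _ => integrable_haarU (by fun_prop)]
  exact Finset.sum_congr rfl fun b _ => integral_mul_const _ _

theorem haarTwirl_conjBy_basisEmb_apply_of_injective2 {w : Fin t → Conf ι₀ → Conf ι}
    (hw : Function.Injective2 w) {u : Fin t → Conf ι} (hu : Function.Injective u)
    (ρ : Op ((Fin t × ι₀) ⊕ κ)) (x y : Conf ((Fin t × ι) ⊕ κ)) :
    haarTwirl (conjBy (ampliate κ (tensorFam fun j => basisEmb (w j))) ρ) x y =
      haarMoment (fun j i => x (Sum.inl (j, i))) (fun j i => y (Sum.inl (j, i))) u u *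
        traceLeft ρ (x ∘ Sum.inr) (y ∘ Sum.inr) := by
  rw [haarTwirl_conjBy_basisEmb_apply, traceLeft, Finset.mul_sum,
    ← (Equiv.curry (Fin t) ι₀ Bool).symm.sum_comp]
  refine Finset.sum_congr rfl fun a _ => ?_
  rw [Finset.sum_eq_single a]
  · rw [haarMoment_eq_of_injective _ _ (fun i j hij => (hw hij).1) hu]
    rfl
  · intro b _ hba
    obtain ⟨j, hj⟩ := Function.ne_iff.1 hba.symm
    rw [haarMoment_eq_zero _ _ _ _ j (fun i hij => (hw hij).1), zero_mul]
    intro i hij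
    obtain ⟨rfl, hab⟩ := hw hij
    exact hj hab.symm
  · simp

theorem traceNorm_haarTwirl_parallel_sub_le {S : Type*} [Fintype S] [Nonempty S]
    {v : S → Conf ι₀ → Conf ι} (hv : Function.Injective2 v)
    {v' : S → Conf ι₁ → Conf ι} (hv' : Function.Injective2 v')
    {ρ : Op ((Fin t × ι₀) ⊕ κ)} (hρ : IsDensity ρ) {ρ' : Op ((Fin t × ι₁) ⊕ κ)}
    (hρ' : IsDensity ρ') (h : traceLeft ρ = traceLeft ρ') :
    traceNorm (haarTwirl (parallel t (avgConjBy fun s => basisEmb (v s)) ρ) -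
      haarTwirl (parallel t (avgConjBy fun s => basisEmb (v' s)) ρ')) ≤
      2 * ((t : ℝ) ^ 2 / Fintype.card S) := by
  classical
  simp only [parallel_avgConjBy, avgConjBy_apply, map_smul, map_sum]
  refine (traceNorm_average_sub_average_le ?_ ?_ (fun s => ¬Function.Injective s) ?_).trans
    (mul_le_mul_of_nonneg_left (card_not_injective_div_card_le S t) zero_le_two)
  · exact fun s => (hρ.conjBy (conjTranspose_mul_ampliate_tensorFam fun j =>
      conjTranspose_mul_basisEmb (hv.right _))).haarTwirl
  · exact fun s => (hρ'.conjBy (conjTranspose_mul_ampliate_tensorFam fun j =>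
      conjTranspose_mul_basisEmb (hv'.right _))).haarTwirl
  · intro s hs
    rw [not_not] at hs
    have hvs : Function.Injective2 fun j => v (s j) := fun _ _ _ _ h => ⟨hs (hv h).1, (hv h).2⟩
    have hvs' : Function.Injective2 fun j => v' (s j) := fun _ _ _ _ h => ⟨hs (hv' h).1, (hv' h).2⟩
    ext x y
    rw [haarTwirl_conjBy_basisEmb_apply_of_injective2 hvs (hvs.left fun _ => false),
      haarTwirl_conjBy_basisEmb_apply_of_injective2 hvs' (hvs.left fun _ => false), h]

end HaarTwirl

section Encrypt

theorem append_eq_iff {α : Type*} {m n : ℕ} {a : Fin m → α} {b : Fin n → α} {x : Fin (m + n) → α} :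
    Fin.append a b = x ↔ a = x ∘ Fin.castAdd n ∧ b = x ∘ Fin.natAdd m := by
  rw [← Prod.mk_inj]
  exact (Fin.appendEquiv (α := α) m n).eq_symm_apply (x := x) (y := (a, b)) |>.symm

theorem append_inj_iff {α : Type*} {m n : ℕ} {a a' : Fin m → α} {b b' : Fin n → α} :
    Fin.append a b = Fin.append a' b' ↔ a = a' ∧ b = b' := by
  rw [← Prod.mk_inj]
  exact (Fin.appendEquiv (α := α) m n).injective.eq_iff (a := (a, b)) (b := (a', b'))

variable {n ℓ m t : ℕ} {κ : Type}

/-- The label `|a⟩|0⟩|s⟩` of a basis state in the support of `padState ℓ m |a⟩⟨a|`. -/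
def padConf (ℓ : ℕ) (s : Conf (Fin m)) (a : Conf (Fin n)) : Conf (Fin (n + ℓ + m)) :=
  Fin.append (Fin.append a fun _ => false) s

theorem injective2_padConf : Function.Injective2 (padConf (n := n) (m := m) ℓ) := by
  intro s s' a a' h
  simp only [padConf, append_inj_iff, and_true] at h
  exact h.symm

theorem padState_eq_avgConjBy (ρ : Op (Fin n)) :
    padState ℓ m ρ = avgConjBy (fun s => basisEmb (padConf ℓ s)) ρ := by
  have hentry (x y : Conf (Fin (n + ℓ + m))) : padState ℓ m ρ x y =
      tensor (tensor ρ (zeroState (Fin ℓ))) (maxMixed (Fin m))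
        (Sum.elim (Sum.elim ((x ∘ Fin.castAdd m) ∘ Fin.castAdd ℓ)
          ((x ∘ Fin.castAdd m) ∘ Fin.natAdd n)) (x ∘ Fin.natAdd (n + ℓ)))
        (Sum.elim (Sum.elim ((y ∘ Fin.castAdd m) ∘ Fin.castAdd ℓ)
          ((y ∘ Fin.castAdd m) ∘ Fin.natAdd n)) (y ∘ Fin.natAdd (n + ℓ))) := by
    rw [padState, relabel]
    congr 1 <;> ext ((_ | _) | _) <;> rfl
  have hemb (s : Conf (Fin m)) (x : Conf (Fin (n + ℓ + m))) (a : Conf (Fin n)) :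
      basisEmb (padConf ℓ s) x a =
        if a = (x ∘ Fin.castAdd m) ∘ Fin.castAdd ℓ then
          if (x ∘ Fin.castAdd m) ∘ Fin.natAdd n = fun _ => false then
            if s = x ∘ Fin.natAdd (n + ℓ) then 1 else 0
          else 0
        else 0 := by
    simp only [basisEmb, padConf, Matrix.submatrix_apply, id, Matrix.one_apply, eq_comm (a := x),
      append_eq_iff, ite_and, eq_comm (a := fun _ => false)]
  ext x y
  by_cases h : x ∘ Fin.natAdd (n + ℓ) = y ∘ Fin.natAdd (n + ℓ)
  · simp only [hentry, tensor, h, Sum.elim_comp_inl, zeroState, basisState, Sum.elim_comp_inr,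
      Matrix.single_apply, eq_comm (a := fun _ => false), ite_and, mul_ite, mul_one, mul_zero,
      maxMixed, Fintype.card_fin, Matrix.smul_apply, Matrix.one_apply_eq, smul_eq_mul, mul_comm,
      one_mul, zero_mul, avgConjBy_apply, Fintype.card_pi, Fintype.card_bool, Finset.prod_const,
      Finset.card_univ, Nat.cast_pow, Nat.cast_ofNat, Matrix.sum_apply, conjBy_apply_apply, hemb,
      RCLike.star_def, apply_ite (starRingEnd ℂ), map_one, map_zero, ite_self,
      Finset.sum_ite_eq', Finset.mem_univ, if_true, Finset.sum_ite_irrel, Finset.sum_const_zero]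
    split_ifs <;> rfl
  · simp [hentry, hemb, tensor, maxMixed, avgConjBy_apply, conjBy_apply_apply, Matrix.sum_apply,
      apply_ite (starRingEnd ℂ), h, Ne.symm h]

theorem encrypt_eq_conjBy_comp (U : UGroup (Fin (n + ℓ + m))) :
    encrypt (n := n) U = conjBy (U : Op (Fin (n + ℓ + m))) ∘ₗ
      avgConjBy fun s => basisEmb (padConf ℓ s) := by
  ext1 ρ
  rw [LinearMap.comp_apply, ← padState_eq_avgConjBy]
  rfl

variable [Fintype κ] [DecidableEq κ]

theorem parallel_encrypt (U : UGroup (Fin (n + ℓ + m))) (ρ : Op ((Fin t × Fin n) ⊕ κ)) :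
    parallel t (encrypt U) ρ = conjBy (ampliate κ (tensorPow t (U : Op (Fin (n + ℓ + m)))))
      (parallel t (avgConjBy fun s => basisEmb (padConf ℓ s)) ρ) := by
  rw [encrypt_eq_conjBy_comp, parallel_conjBy_comp, tensorPow_eq_tensorFam]

theorem parallel_encrypt_mul (U W : UGroup (Fin (n + ℓ + m))) (ρ : Op ((Fin t × Fin n) ⊕ κ)) :
    parallel t (encrypt (U * W)) ρ =
      conjBy (ampliate κ (tensorPow t (U : Op (Fin (n + ℓ + m))))) (parallel t (encrypt W) ρ) := by
  have h : encrypt (n := n) (U * W) = conjBy (U : Op (Fin (n + ℓ + m))) ∘ₗ encrypt W := by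
    rw [encrypt_eq_conjBy_comp, encrypt_eq_conjBy_comp, ← LinearMap.comp_assoc, ← conjBy_mul]
    rfl
  rw [h, parallel_conjBy_comp, tensorPow_eq_tensorFam]

theorem IsDensity.parallel_encrypt (U : UGroup (Fin (n + ℓ + m))) {ρ : Op ((Fin t × Fin n) ⊕ κ)}
    (hρ : IsDensity ρ) : IsDensity (parallel t (encrypt U) ρ) := by
  rw [QCrypto.parallel_encrypt]
  refine IsDensity.conjBy_ampliate_tensorPow (hρ.parallel_avgConjBy fun s => ?_) U
  exact conjTranspose_mul_basisEmb (injective2_padConf.right s)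

theorem continuous_parallel_encrypt {κ : Type} [Finite κ] (ρ : Op ((Fin t × Fin n) ⊕ κ)) :
    Continuous fun U : UGroup (Fin (n + ℓ + m)) => parallel t (encrypt U) ρ := by
  classical
  have := Fintype.ofFinite κ
  simp only [QCrypto.parallel_encrypt]
  exact continuous_conjBy_ampliate_tensorPow _

theorem traceNorm_haarMean_parallel_encrypt_sub_le {ρ : Op ((Fin t × Fin n) ⊕ κ)}
    (hρ : IsDensity ρ) :
    traceNorm (haarMean (fun U : UGroup (Fin (n + ℓ + m)) => parallel t (encrypt U) ρ) -
      tensor (tensorPow t (maxMixed (Fin (n + ℓ + m)))) (traceLeft ρ)) ≤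
      2 * ((t : ℝ) ^ 2 / 2 ^ m) := by
  set τ := tensor (tensorPow t (maxMixed (Fin (n + ℓ)))) (traceLeft ρ) with hτ
  set v := fun (s : Conf (Fin m)) (a : Conf (Fin (n + ℓ))) => Fin.append a s
  have hv : Function.Bijective (Function.uncurry v) :=
    ((Equiv.prodComm _ _).trans (Fin.appendEquiv _ _)).bijective
  have hv2 : Function.Injective2 v := fun _ _ _ _ h => (append_inj_iff.1 h).symm
  have hmaxMixed : IsDensity (tensorPow t (maxMixed (Fin (n + ℓ)))) :=
    isDensity_maxMixed.tensorPow
  have hleft : traceLeft ρ = traceLeft τ := by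
    rw [hτ, traceLeft_tensor, hmaxMixed.2, one_smul]
  have htwirl : haarTwirl (parallel t (avgConjBy fun s => basisEmb (v s)) τ) =
      tensor (tensorPow t (maxMixed (Fin (n + ℓ + m)))) (traceLeft ρ) := by
    rw [hτ, parallel_tensor_tensorPow, avgConjBy_basisEmb_maxMixed hv,
      haarTwirl_tensorPow_maxMixed]
  have hcard : (Fintype.card (Conf (Fin m)) : ℝ) = 2 ^ m := by simp
  simp only [QCrypto.parallel_encrypt, ← haarTwirl_apply]
  rw [← htwirl, ← hcard]
  exact traceNorm_haarTwirl_parallel_sub_le injective2_padConf hv2 hρ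
    (hmaxMixed.tensor hρ.traceLeft) hleft

end Encrypt

section Circuits

variable {ι κ μ : Type}

theorem actOn_trans (g : κ ↪ ι) (f : ι ↪ μ) (u : Op κ) :
    actOn (g.trans f) u = actOn f (actOn g u) := by
  classical
  ext x y
  have h : (∀ i, i ∉ Set.range (g.trans f) → x i = y i) ↔
      (∀ i, i ∉ Set.range f → x i = y i) ∧ ∀ i, i ∉ Set.range g → x (f i) = y (f i) := by
    refine ⟨fun h => ⟨fun i hi => h i ?_, fun i hi => h (f i) ?_⟩, fun h i hi => ?_⟩
    · rintro ⟨k, rfl⟩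
      exact hi ⟨g k, rfl⟩
    · rintro ⟨k, hk⟩
      exact hi ⟨k, f.injective hk⟩
    · by_cases hf : i ∈ Set.range f
      · obtain ⟨j, rfl⟩ := hf
        exact h.2 j fun ⟨k, hk⟩ => hi ⟨k, congrArg f hk⟩
      · exact h.1 i hf
  rw [actOn, actOn, actOn, if_congr h rfl rfl, ite_and]
  rfl

theorem actOn_equiv (e : ι ≃ μ) (u : Op ι) : actOn e.toEmbedding u = relabel e u := by
  ext x y
  simp [actOn, relabel]

theorem actOn_inl [Fintype μ] (u : Op ι) :
    actOn (Function.Embedding.inl : ι ↪ ι ⊕ μ) u = tensor u 1 := by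
  ext x y
  have h : (∀ i, i ∉ Set.range (Function.Embedding.inl : ι ↪ ι ⊕ μ) → x i = y i) ↔
      x ∘ Sum.inr = y ∘ Sum.inr := by
    simp [funext_iff]
  simp only [actOn, tensor, h, Matrix.one_apply, mul_ite, mul_one, mul_zero]
  rfl

theorem actOn_sectR [Fintype ι] {t : ℕ} (j : Fin t) (u : Op ι) :
    actOn (Function.Embedding.sectR j ι) u = tensorFam (Pi.mulSingle j u) := by
  ext x y
  have h : (∀ i, i ∉ Set.range (Function.Embedding.sectR j ι) → x i = y i) ↔
      ∀ k ∈ Finset.univ.erase j, (fun i => x (k, i)) = fun i => y (k, i) := by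
    simp only [Set.mem_range, Function.Embedding.sectR_apply, Prod.forall, Prod.mk.injEq,
      not_exists, not_and, Finset.mem_erase, Finset.mem_univ, and_true, funext_iff]
    exact ⟨fun h k hk i => h k i fun _ hkj => absurd hkj.symm hk,
      fun h k i hk => h k (fun hkj => hk i hkj.symm rfl) i⟩
  have hone : ∀ k ∈ Finset.univ.erase j,
      (Pi.mulSingle j u : Fin t → Op ι) k (fun i => x (k, i)) (fun i => y (k, i)) =
        if (fun i => x (k, i)) = fun i => y (k, i) then 1 else 0 := by
    intro k hk
    rw [Pi.mulSingle_eq_of_ne (Finset.ne_of_mem_erase hk), Matrix.one_apply]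
  rw [tensorFam, ← Finset.mul_prod_erase _ _ (Finset.mem_univ j), Pi.mulSingle_eq_same,
    Finset.prod_congr rfl hone, Finset.prod_ite_zero, Finset.prod_const_one, mul_ite, mul_one,
    mul_zero]
  rw [actOn]
  congr 1
  exact propext h

theorem conjTranspose_actOn (f : κ ↪ ι) (u : Op κ) :
    (actOn f u).conjTranspose = actOn f u.conjTranspose := by
  classical
  ext x y
  rw [Matrix.conjTranspose_apply, actOn, apply_ite star, star_zero]
  exact if_congr (forall₂_congr fun _ _ => eq_comm) rfl rfl

theorem exists_actOn_eq_relabel_tensor [Finite ι] (f : κ ↪ ι) :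
    ∃ (ν : Type) (_ : Fintype ν) (_ : DecidableEq ν) (e : κ ⊕ ν ≃ ι),
      ∀ u : Op κ, actOn f u = relabel e (tensor u (1 : Op ν)) := by
  classical
  have := Fintype.ofFinite ι
  refine ⟨((Set.range f)ᶜ : Set ι), inferInstance, inferInstance,
    ((Equiv.ofInjective f f.injective).sumCongr (Equiv.refl _)).trans
      (Equiv.Set.sumCompl (Set.range f)), fun u => ?_⟩
  rw [← actOn_inl, ← actOn_equiv, ← actOn_trans]
  rfl

variable [Fintype ι] [Fintype κ]

theorem actOn_one (f : κ ↪ ι) : actOn f (1 : Op κ) = 1 := by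
  obtain ⟨ν, _, _, e, he⟩ := exists_actOn_eq_relabel_tensor f
  rw [he, tensor_one_eq_ampliate, ampliate_one, relabel_one]

variable [DecidableEq ι]

theorem actOn_mul [DecidableEq κ] (f : κ ↪ ι) (u v : Op κ) :
    actOn f (u * v) = actOn f u * actOn f v := by
  obtain ⟨ν, _, _, e, he⟩ := exists_actOn_eq_relabel_tensor f
  rw [he, he, he, ← relabel_mul, tensor_mul_tensor, Matrix.one_mul]

theorem Gate.conjTranspose_op_mul_op (g : Gate ι) : g.op.conjTranspose * g.op = 1 := by
  have h : (g.unitary : Op (Fin g.arity)).conjTranspose * g.unitary = 1 :=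
    Unitary.coe_star_mul_self g.unitary
  rw [Gate.op, conjTranspose_actOn, ← actOn_mul, h, actOn_one]

theorem conjTranspose_circuitOp_mul (C : List (Gate ι)) :
    (circuitOp C).conjTranspose * circuitOp C = 1 := by
  induction C with
  | nil => simp [circuitOp]
  | cons g C ih =>
    rw [circuitOp, Matrix.conjTranspose_mul, Matrix.mul_assoc,
      ← Matrix.mul_assoc (circuitOp C).conjTranspose, ih, Matrix.one_mul,
      g.conjTranspose_op_mul_op]

/-- The gate that acts on the images of the wires of `g` under an embedding of registers. -/
def Gate.map {ι μ : Type} (f : ι ↪ μ) (g : Gate ι) : Gate μ :=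
  ⟨g.arity, g.arity_le, g.wires.trans f, g.unitary⟩

variable [Fintype μ] [DecidableEq μ]

theorem circuitOp_map (f : ι ↪ μ) (C : List (Gate ι)) :
    circuitOp (C.map (Gate.map f)) = actOn f (circuitOp C) := by
  induction C with
  | nil => exact (actOn_one f).symm
  | cons g C ih =>
    rw [List.map_cons, circuitOp, circuitOp, ih, actOn_mul, Gate.op, Gate.op, ← actOn_trans]
    rfl

theorem oracleCircuitOp_append {N : ℕ} (U : UGroup (Fin N)) (C D : List (Gate ι ⊕ (Fin N ↪ ι))) :
    oracleCircuitOp U (C ++ D) = oracleCircuitOp U D * oracleCircuitOp U C := by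
  induction C with
  | nil => simp [oracleCircuitOp]
  | cons g C ih =>
    cases g <;> simp only [List.cons_append, oracleCircuitOp, ih, Matrix.mul_assoc]

theorem oracleCircuitOp_map_inl {N : ℕ} (U : UGroup (Fin N)) (C : List (Gate ι)) :
    oracleCircuitOp U (C.map Sum.inl) = circuitOp C := by
  induction C with
  | nil => rfl
  | cons g C ih => rw [List.map_cons, oracleCircuitOp, circuitOp, ih]

theorem oracleCircuitOp_queries {N t : ℕ} (U : UGroup (Fin N)) (f : Fin t × Fin N ↪ ι)
    {l : List (Fin t)} (hl : l.Nodup) :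
    oracleCircuitOp U (l.map fun j => Sum.inr ((Function.Embedding.sectR j (Fin N)).trans f)) =
      actOn f (tensorFam fun j => if j ∈ l then (U : Op (Fin N)) else 1) := by
  induction l with
  | nil =>
    simp only [List.map_nil, oracleCircuitOp, List.not_mem_nil, if_false, tensorFam_one, actOn_one]
  | cons j l ih =>
    rw [List.map_cons, oracleCircuitOp, ih hl.of_cons, actOn_trans, actOn_sectR, ← actOn_mul,
      ← tensorFam_mul]
    congr 2
    ext1 i
    by_cases hij : i = j
    · subst hij
      simp [(List.nodup_cons.1 hl).1]
    · simp [hij]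

theorem oracleCircuitOp_finRange {N t : ℕ} (U : UGroup (Fin N)) (f : Fin t × Fin N ↪ ι) :
    oracleCircuitOp U ((List.finRange t).map fun j =>
      Sum.inr ((Function.Embedding.sectR j (Fin N)).trans f)) =
      actOn f (tensorPow t (U : Op (Fin N))) := by
  rw [oracleCircuitOp_queries U f (List.nodup_finRange t), tensorPow_eq_tensorFam]
  simp only [List.mem_finRange, if_true]

end Circuits

section Probabilities

variable {ι μ : Type} [Fintype ι] [DecidableEq ι] [Fintype μ] [DecidableEq μ]

theorem probOne_add (i : ι) (ρ τ : Op ι) : probOne i (ρ + τ) = probOne i ρ + probOne i τ := by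
  simp only [probOne, Matrix.add_apply, Complex.add_re, ← Finset.sum_add_distrib]
  exact Finset.sum_congr rfl fun x _ => by split_ifs <;> simp only [add_zero]

theorem probOne_smul (i : ι) (c : ℝ) (ρ : Op ι) : probOne i (c • ρ) = c * probOne i ρ := by
  simp only [probOne, Matrix.smul_apply, Complex.smul_re, smul_eq_mul, Finset.mul_sum, mul_ite,
    mul_zero]

theorem probOne_nonneg (i : ι) {ρ : Op ι} (hρ : ρ.PosSemidef) : 0 ≤ probOne i ρ :=
  Finset.sum_nonneg fun x _ => by
    split_ifs
    exacts [(Complex.le_def.1 (hρ.diag_nonneg (i := x))).1, le_rfl]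

theorem probOne_le_trace (i : ι) {ρ : Op ι} (hρ : ρ.PosSemidef) : probOne i ρ ≤ ρ.trace.re := by
  rw [Matrix.trace, Complex.re_sum]
  refine Finset.sum_le_sum fun x _ => ?_
  split_ifs
  exacts [le_rfl, (Complex.le_def.1 (hρ.diag_nonneg (i := x))).1]

theorem probOne_relabel (e : ι ≃ μ) (i : ι) (ρ : Op ι) :
    probOne (e i) (relabel e ρ) = probOne i ρ :=
  Fintype.sum_equiv (e.arrowCongr (Equiv.refl Bool)).symm _ _ fun _ => rfl

namespace Distinguisher

variable (A : Distinguisher ι)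

/-- The acceptance probability of `A`, as a real linear functional of its input: `prob` makes
sense, and is linear, on all matrices and not only on density matrices. -/
noncomputable def probLinear : Op ι →ₗ[ℝ] ℝ where
  toFun := A.prob
  map_add' ρ τ := by
    have h : tensor (ρ + τ) A.advice = tensor ρ A.advice + tensor τ A.advice := by
      ext x y
      exact add_mul _ _ _
    rw [prob, prob, prob, h, mul_add, add_mul, probOne_add]
  map_smul' c ρ := by
    have h : tensor (c • ρ) A.advice = c • tensor ρ A.advice := by
      ext x y
      exact smul_mul_assoc c (ρ _ _) _
    rw [prob, prob, h, Matrix.mul_smul, Matrix.smul_mul, probOne_smul, RingHom.id_apply,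
      smul_eq_mul]

theorem prob_sub (ρ τ : Op ι) : A.prob (ρ - τ) = A.prob ρ - A.prob τ :=
  map_sub A.probLinear ρ τ

theorem integral_prob {κ : Type} [Fintype κ] [DecidableEq κ] {F : UGroup κ → Op ι}
    (hF : Continuous F) : ∫ U, A.prob (F U) ∂haarU κ = A.prob (haarMean F) :=
  integral_linearMap_comp A.probLinear hF

theorem prob_nonneg {ρ : Op ι} (hρ : ρ.PosSemidef) : 0 ≤ A.prob ρ :=
  probOne_nonneg _ ((posSemidef_tensor hρ A.advice_isDensity.1).mul_mul_conjTranspose_same _)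

theorem prob_le_trace {ρ : Op ι} (hρ : ρ.PosSemidef) : A.prob ρ ≤ ρ.trace.re := by
  refine (probOne_le_trace _ ((posSemidef_tensor hρ
    A.advice_isDensity.1).mul_mul_conjTranspose_same _)).trans_eq ?_
  rw [Matrix.trace_mul_cycle, conjTranspose_circuitOp_mul, Matrix.one_mul, trace_tensor,
    A.advice_isDensity.2, mul_one]

theorem abs_prob_sub_le_traceNorm {ρ τ : Op ι} (hρ : ρ.IsHermitian) (hτ : τ.IsHermitian) :
    |A.prob ρ - A.prob τ| ≤ traceNorm (ρ - τ) := by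
  obtain ⟨P, Q, hP, hQ, hPQ, htr⟩ := exists_posSemidef_sub_eq_and_traceNorm_eq (hρ.sub hτ)
  rw [htr, ← A.prob_sub, ← hPQ, A.prob_sub, abs_le]
  constructor <;>
    linarith [A.prob_nonneg hP, A.prob_nonneg hQ, A.prob_le_trace hP, A.prob_le_trace hQ]

/-- The algorithm that runs `A` on an input register whose qubits are renamed by `e`. -/
def relabel {ι μ : Type} (e : ι ≃ μ) (A : Distinguisher ι) : Distinguisher μ where
  work := A.work
  advice := A.advice
  advice_isDensity := A.advice_isDensity
  circuit := A.circuit.map (Gate.map (e.sumCongr (Equiv.refl _)).toEmbedding)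
  out := e.sumCongr (Equiv.refl _) A.out

theorem prob_relabel (e : ι ≃ μ) (ρ : Op ι) :
    (A.relabel e).prob (QCrypto.relabel e ρ) = A.prob ρ := by
  set e' := e.sumCongr (Equiv.refl (Fin A.work))
  calc (A.relabel e).prob (QCrypto.relabel e ρ)
      = probOne (e' A.out) (conjBy (circuitOp (A.circuit.map (Gate.map e'.toEmbedding)))
          (QCrypto.relabel e' (tensor ρ A.advice))) := rfl
    _ = A.prob ρ := by
        rw [circuitOp_map, actOn_equiv, ← relabel_conjBy, probOne_relabel]
        rfl

end Distinguisher

theorem Distinguisher.size_relabel {ι μ : Type} [Fintype ι] [Fintype μ] (e : ι ≃ μ)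
    (A : Distinguisher ι) : (A.relabel e).size = A.size := by
  simp only [size, relabel, List.length_map, Fintype.card_congr e]

end Probabilities

section Reduction

variable {N t : ℕ} {κ : Type}

/-- The oracle circuit that applies the oracle to each of the `t` blocks of `N` qubits and then
runs `A`, on a register identified by `e` with the input and work qubits of `A`. -/
def Distinguisher.oracleCircuit {ν : Type} (A : Distinguisher ((Fin t × Fin N) ⊕ κ))
    (e : ((Fin t × Fin N) ⊕ κ) ⊕ Fin A.work ≃ ν) : List (Gate ν ⊕ (Fin N ↪ ν)) :=
  ((List.finRange t).map fun j => Sum.inr ((Function.Embedding.sectR j (Fin N)).trans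
      ((Function.Embedding.inl.trans Function.Embedding.inl).trans e.toEmbedding))) ++
    (A.circuit.map (Gate.map e.toEmbedding)).map Sum.inl

variable [Fintype κ]

/-- The oracle algorithm that holds `τ` as part of its advice state, applies its oracle to each of
the `t` blocks of `N` qubits of `τ`, and then runs `A`. -/
noncomputable def Distinguisher.toOracle [DecidableEq κ] (A : Distinguisher ((Fin t × Fin N) ⊕ κ))
    {τ : Op ((Fin t × Fin N) ⊕ κ)} (hτ : IsDensity τ) : OracleDistinguisher N where
  work := Fintype.card (((Fin t × Fin N) ⊕ κ) ⊕ Fin A.work)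
  advice := QCrypto.relabel (Fintype.equivFin _) (tensor τ A.advice)
  advice_isDensity := (hτ.tensor A.advice_isDensity).relabel _
  circuit := A.oracleCircuit (Fintype.equivFin _)
  out := Fintype.equivFin _ A.out

variable [DecidableEq κ] (A : Distinguisher ((Fin t × Fin N) ⊕ κ))

theorem Distinguisher.oracleCircuitOp_oracleCircuit {ν : Type} [Fintype ν] [DecidableEq ν]
    (e : ((Fin t × Fin N) ⊕ κ) ⊕ Fin A.work ≃ ν) (U : UGroup (Fin N)) :
    oracleCircuitOp U (A.oracleCircuit e) = QCrypto.relabel e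
      (circuitOp A.circuit * ampliate (Fin A.work) (ampliate κ (tensorPow t ↑U))) := by
  rw [oracleCircuit, oracleCircuitOp_append, oracleCircuitOp_map_inl, circuitOp_map,
    oracleCircuitOp_finRange, actOn_trans, actOn_equiv, actOn_equiv, ← relabel_mul, actOn_trans,
    actOn_inl, actOn_inl, tensor_one_eq_ampliate, tensor_one_eq_ampliate]

variable {τ : Op ((Fin t × Fin N) ⊕ κ)} (hτ : IsDensity τ)

theorem Distinguisher.size_toOracle : (A.toOracle hτ).size = A.size + t := by
  simp only [OracleDistinguisher.size, toOracle, oracleCircuit, size, Fintype.card_sum,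
    Fintype.card_fin, List.length_append, List.length_map, List.length_finRange]
  ring

theorem Distinguisher.prob_toOracle (U : UGroup (Fin N)) :
    (A.toOracle hτ).prob U = A.prob (conjBy (ampliate κ (tensorPow t ↑U)) τ) := by
  set e := Fintype.equivFin (((Fin t × Fin N) ⊕ κ) ⊕ Fin A.work)
  calc (A.toOracle hτ).prob U
      = probOne (e A.out) (conjBy (oracleCircuitOp U (A.oracleCircuit e))
          (QCrypto.relabel e (tensor τ A.advice))) := rfl
    _ = probOne A.out (conjBy (circuitOp A.circuit)
          (conjBy (ampliate (Fin A.work) (ampliate κ (tensorPow t ↑U))) (tensor τ A.advice))) := by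
        rw [A.oracleCircuitOp_oracleCircuit, ← relabel_conjBy, probOne_relabel, conjBy_mul,
          LinearMap.comp_apply]
    _ = A.prob (conjBy (ampliate κ (tensorPow t ↑U)) τ) := by
        rw [conjBy_ampliate_tensor]
        rfl

theorem exists_abs_uniformAvg_sub_le {K L : Type} [Fintype K] [Fintype L] [Nonempty L]
    (f : K × L → ℝ) (c : ℝ) :
    ∃ l, |uniformAvg f - c| ≤ |uniformAvg (fun k => f (k, l)) - c| := by
  obtain ⟨l, hl⟩ := Finite.exists_max fun l => |uniformAvg (fun k => f (k, l)) - c|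
  refine ⟨l, ?_⟩
  have hL : (0 : ℝ) < Fintype.card L := by exact_mod_cast Fintype.card_pos
  have h : uniformAvg f - c =
      (∑ l, (uniformAvg (fun k => f (k, l)) - c)) / Fintype.card L := by
    simp only [uniformAvg, Finset.sum_sub_distrib, ← Finset.sum_div, Fintype.sum_prod_type_right,
      Fintype.card_prod, Finset.sum_const, Finset.card_univ, nsmul_eq_mul, Nat.cast_mul]
    field_simp
  rw [h, abs_div, abs_of_pos hL, div_le_iff₀ hL, mul_comm, ← nsmul_eq_mul, ← Finset.card_univ]
  exact (Finset.abs_sum_le_sum_abs _ _).trans (Finset.sum_le_card_nsmul _ _ _ fun x _ => hl x)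

end Reduction

section Asymptotics

theorem PolyBounded.add {f g : ℕ → ℕ} (hf : PolyBounded f) (hg : PolyBounded g) :
    PolyBounded fun n => f n + g n := by
  obtain ⟨c, hc⟩ := hf
  obtain ⟨d, hd⟩ := hg
  refine ⟨c + d + 2, fun n => ?_⟩
  have h : n ^ c + n ^ d ≤ n ^ (c + d + 2) + 2 := by
    rcases Nat.eq_zero_or_pos n with rfl | hn
    · have hz (k : ℕ) : 0 ^ k ≤ 1 := pow_le_one₀ le_rfl zero_le_one
      linarith [hz c, hz d, Nat.zero_le (0 ^ (c + d + 2))]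
    · have hcd : n ^ (c + d) ≤ n ^ (c + d + 2) := Nat.pow_le_pow_right hn (Nat.le_add_right _ _)
      rw [pow_add n c d] at hcd
      nlinarith [Nat.one_le_pow c n hn, Nat.one_le_pow d n hn]
  linarith [hc n, hd n]

theorem eventually_pow_le_two_pow {m : ℕ → ℕ}
    (hm : (fun n : ℕ => Real.log n) =o[Filter.atTop] fun n : ℕ => (m n : ℝ)) (c : ℕ) :
    ∀ᶠ n : ℕ in Filter.atTop, (n : ℝ) ^ c ≤ 2 ^ m n := by
  have hlog : 0 < Real.log 2 := Real.log_pos one_lt_two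
  filter_upwards [(hm.const_mul_left c).bound hlog, Filter.eventually_gt_atTop 0] with n hn hn0
  have hn0' : (0 : ℝ) < n := Nat.cast_pos.2 hn0
  rw [← Real.log_le_log_iff (by positivity) (by positivity), Real.log_pow, Real.log_pow, mul_comm]
  rw [Real.norm_eq_abs, Real.norm_eq_abs, Nat.abs_cast] at hn
  linarith [le_abs_self ((c : ℝ) * Real.log n)]

theorem negligible_inv_two_pow {m : ℕ → ℕ}
    (hm : (fun n : ℕ => Real.log n) =o[Filter.atTop] fun n : ℕ => (m n : ℝ)) :
    Negligible fun n => ((2 : ℝ) ^ m n)⁻¹ := by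
  refine (negligible_iff _).2 fun c => ?_
  obtain ⟨n₀, h⟩ := Filter.eventually_atTop.1 (eventually_pow_le_two_pow hm (c + 1))
  refine ⟨max n₀ 1, fun n hn => ?_⟩
  have hn1 : (1 : ℝ) < n := Nat.one_lt_cast.2 ((le_max_right _ _).trans_lt hn)
  rw [abs_of_pos (by positivity)]
  exact inv_strictAnti₀ (by positivity)
    ((pow_lt_pow_right₀ hn1 c.lt_succ_self).trans_le (h n ((le_max_left _ _).trans hn.le)))

theorem negligible_sq_div_two_pow {m t : ℕ → ℕ}
    (hm : (fun n : ℕ => Real.log n) =o[Filter.atTop] fun n : ℕ => (m n : ℝ))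
    (ht : PolyBounded t) :
    Negligible fun n => (t n : ℝ) ^ 2 / 2 ^ m n := by
  obtain ⟨d, hd⟩ := ht
  refine ((negligible_inv_two_pow hm).polynomial_mul
    ((Polynomial.X ^ d + Polynomial.C (d : ℝ)) ^ 2)).trans_abs_le fun n => ?_
  have htn : (t n : ℝ) ≤ (n : ℝ) ^ d + d := by exact_mod_cast hd n
  simp only [Polynomial.eval_pow, Polynomial.eval_add, Polynomial.eval_X, Polynomial.eval_C]
  rw [div_eq_mul_inv, abs_of_nonneg (by positivity), abs_of_nonneg (by positivity)]
  gcongr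

end Asymptotics

/-- Pseudorandomness of a keyed family of unitaries, without the two efficiency requirements of
`IsPRU`: no polynomial-size quantum algorithm with oracle access distinguishes `V n k`, for a
uniformly random key `k`, from a Haar random unitary. The keys may form any finite sets. -/
def IsHaarPseudorandom (N : ℕ → ℕ) {K : ℕ → Type} [∀ n, Fintype (K n)]
    (V : ∀ n, K n → UGroup (Fin (N n))) : Prop :=
  ∀ A : ∀ n, OracleDistinguisher (N n), PolyBounded (fun n => (A n).size) →
    Negligible fun n =>
      |uniformAvg (fun k => (A n).prob (V n k)) - ∫ U, (A n).prob U ∂haarU (Fin (N n))|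

section Security

variable {n ℓ m t : ℕ} {κ : Type} [Fintype κ] [DecidableEq κ]
  (A : Distinguisher ((Fin t × Fin (n + ℓ + m)) ⊕ κ)) {ρ : Op ((Fin t × Fin n) ⊕ κ)}

theorem Distinguisher.abs_prob_haarMean_parallel_encrypt_sub_le (hρ : IsDensity ρ) :
    |A.prob (haarMean fun U => parallel t (encrypt U) ρ) -
      A.prob (tensor (tensorPow t (maxMixed (Fin (n + ℓ + m)))) (traceLeft ρ))| ≤
      2 * ((t : ℝ) ^ 2 / 2 ^ m) :=
  (A.abs_prob_sub_le_traceNorm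
    (IsDensity.haarMean (continuous_parallel_encrypt ρ) hρ.parallel_encrypt).1.isHermitian
    (isDensity_maxMixed.tensorPow.tensor hρ.traceLeft).1.isHermitian).trans
    (traceNorm_haarMean_parallel_encrypt_sub_le hρ)

theorem Distinguisher.integral_prob_parallel_encrypt_mul (W : UGroup (Fin (n + ℓ + m)))
    (ρ : Op ((Fin t × Fin n) ⊕ κ)) :
    ∫ U, A.prob (parallel t (encrypt (U * W)) ρ) ∂haarU (Fin (n + ℓ + m)) =
      A.prob (haarMean fun U => parallel t (encrypt U) ρ) := by
  rw [integral_mul_right_eq_self (fun U => A.prob (parallel t (encrypt U) ρ)) W]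
  exact A.integral_prob (continuous_parallel_encrypt ρ)

theorem Distinguisher.exists_oracleDistinguisher_of_parallel_encrypt {K L : Type} [Fintype K]
    [Fintype L] [Nonempty L] (V : K → UGroup (Fin (n + ℓ + m))) (W : L → UGroup (Fin (n + ℓ + m)))
    (hρ : IsDensity ρ) :
    ∃ B : OracleDistinguisher (n + ℓ + m), B.size = A.size + t ∧
      |uniformAvg (fun k : K × L => A.prob (parallel t (encrypt (V k.1 * W k.2)) ρ)) -
          A.prob (tensor (tensorPow t (maxMixed (Fin (n + ℓ + m)))) (traceLeft ρ))| ≤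
        |uniformAvg (fun k => B.prob (V k)) - ∫ U, B.prob U ∂haarU (Fin (n + ℓ + m))| +
          2 * ((t : ℝ) ^ 2 / 2 ^ m) := by
  set h := A.prob (haarMean fun U => parallel t (encrypt U) ρ)
  obtain ⟨l, hl⟩ := exists_abs_uniformAvg_sub_le
    (fun k : K × L => A.prob (parallel t (encrypt (V k.1 * W k.2)) ρ)) h
  set B := A.toOracle (hρ.parallel_encrypt (W l))
  have hB (U) : B.prob U = A.prob (parallel t (encrypt (U * W l)) ρ) := by
    rw [A.prob_toOracle, ← parallel_encrypt_mul]
  refine ⟨B, A.size_toOracle _, (abs_sub_le _ h _).trans (add_le_add ?_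
    (A.abs_prob_haarMean_parallel_encrypt_sub_le hρ))⟩
  simpa only [hB, A.integral_prob_parallel_encrypt_mul] using hl

end Security

namespace IsHaarPseudorandom

variable {p ℓ m t : ℕ → ℕ} {K L : ℕ → Type} [∀ n, Fintype (K n)] [∀ n, Fintype (L n)]
  [∀ n, Nonempty (L n)] {V : ∀ n, K n → UGroup (Fin (p n + ℓ n + m n))}

theorem negligible_prob_parallel_encrypt_sub
    (hV : IsHaarPseudorandom (fun n => p n + ℓ n + m n) V)
    (W : ∀ n, L n → UGroup (Fin (p n + ℓ n + m n)))
    (hm : (fun n : ℕ => Real.log n) =o[Filter.atTop] fun n : ℕ => (m n : ℝ)) (ht : PolyBounded t)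
    {κ : ℕ → Type} [∀ n, Fintype (κ n)] [∀ n, DecidableEq (κ n)]
    {ρ : ∀ n, Op ((Fin (t n) × Fin (p n)) ⊕ κ n)} (hρ : ∀ n, IsDensity (ρ n))
    (A : ∀ n, Distinguisher ((Fin (t n) × Fin (p n + ℓ n + m n)) ⊕ κ n))
    (hA : PolyBounded fun n => (A n).size) :
    Negligible fun n =>
      |uniformAvg (fun k : K n × L n =>
          (A n).prob (parallel (t n) (encrypt (V n k.1 * W n k.2)) (ρ n))) -
        (A n).prob (tensor (tensorPow (t n) (maxMixed (Fin (p n + ℓ n + m n))))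
          (traceLeft (ρ n)))| := by
  choose B hBsize hB using fun n =>
    (A n).exists_oracleDistinguisher_of_parallel_encrypt (V n) (W n) (hρ n)
  have hBpoly : PolyBounded fun n => (B n).size := by
    simpa only [hBsize] using hA.add ht
  refine ((hV B hBpoly).add ((negligible_sq_div_two_pow hm ht).const_mul 2)).trans_abs_le
    fun n => ?_
  rw [abs_abs]
  exact (hB n).trans (le_abs_self _)

theorem negligible_prob_tensorPow_encrypt_sub
    (hV : IsHaarPseudorandom (fun n => p n + ℓ n + m n) V)
    (W : ∀ n, L n → UGroup (Fin (p n + ℓ n + m n)))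
    (hm : (fun n : ℕ => Real.log n) =o[Filter.atTop] fun n : ℕ => (m n : ℝ)) (ht : PolyBounded t)
    {ρ : ∀ n, Op (Fin (p n))} (hρ : ∀ n, IsDensity (ρ n))
    (A : ∀ n, Distinguisher (Fin (t n) × Fin (p n + ℓ n + m n)))
    (hA : PolyBounded fun n => (A n).size) :
    Negligible fun n =>
      |uniformAvg (fun k : K n × L n =>
          (A n).prob (tensorPow (t n) (encrypt (V n k.1 * W n k.2) (ρ n)))) -
        (A n).prob (tensorPow (t n) (maxMixed (Fin (p n + ℓ n + m n))))| := by
  have hone : IsDensity (1 : Op Empty) := ⟨Matrix.PosSemidef.one, by simp [Matrix.trace]⟩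
  have h := hV.negligible_prob_parallel_encrypt_sub W hm ht (κ := fun _ => Empty)
    (fun n => (hρ n).tensorPow.tensor hone)
    (fun n => (A n).relabel (Equiv.sumEmpty _ Empty).symm)
    (by simpa only [Distinguisher.size_relabel] using hA)
  simp only [parallel_tensor_tensorPow, traceLeft_tensor, (hρ _).tensorPow.2, one_smul] at h
  simpa only [← relabel_sumEmpty_symm, Distinguisher.prob_relabel] using h

end IsHaarPseudorandom

end QCrypto

theorem theorem1_general :
    (∀ (n ℓ m t : ℕ) (κ : Type) [Fintype κ] [DecidableEq κ] (ρ : Op ((Fin t × Fin n) ⊕ κ)),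
      IsDensity ρ →
      traceNorm (haarMean (fun U : UGroup (Fin (n + ℓ + m)) => parallel t (encrypt U) ρ) -
          tensor (tensorPow t (maxMixed (Fin (n + ℓ + m)))) (traceLeft ρ)) ≤
        2 * ((t : ℝ) ^ 2 / 2 ^ m)) ∧
    ∀ (p ℓ m : ℕ → ℕ) (K L : ℕ → Type) [∀ n, Fintype (K n)] [∀ n, Fintype (L n)]
      [∀ n, Nonempty (L n)] (V : ∀ n, K n → UGroup (Fin (p n + ℓ n + m n)))
      (W : ∀ n, L n → UGroup (Fin (p n + ℓ n + m n)))
      (_ : (fun n : ℕ => Real.log n) =o[Filter.atTop] fun n : ℕ => (m n : ℝ))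
      (_ : IsHaarPseudorandom (fun n => p n + ℓ n + m n) V)
      (t : ℕ → ℕ) (_ : PolyBounded t),
      (∀ (κ : ℕ → Type) [∀ n, Fintype (κ n)] [∀ n, DecidableEq (κ n)]
        (ρ : ∀ n, Op ((Fin (t n) × Fin (p n)) ⊕ κ n)), (∀ n, IsDensity (ρ n)) →
        ∀ A : ∀ n, Distinguisher ((Fin (t n) × Fin (p n + ℓ n + m n)) ⊕ κ n),
          PolyBounded (fun n => (A n).size) →
          Negligible fun n =>
            |uniformAvg (fun k : K n × L n =>
                (A n).prob (parallel (t n) (encrypt (V n k.1 * W n k.2)) (ρ n))) -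
              (A n).prob (tensor (tensorPow (t n) (maxMixed (Fin (p n + ℓ n + m n))))
                (traceLeft (ρ n)))|) ∧
      (∀ ρ : ∀ n, Op (Fin (p n)), (∀ n, IsDensity (ρ n)) →
        ∀ A : ∀ n, Distinguisher (Fin (t n) × Fin (p n + ℓ n + m n)),
          PolyBounded (fun n => (A n).size) →
          Negligible fun n =>
            |uniformAvg (fun k : K n × L n =>
                (A n).prob (tensorPow (t n) (encrypt (V n k.1 * W n k.2) (ρ n)))) -
              (A n).prob (tensorPow (t n) (maxMixed (Fin (p n + ℓ n + m n))))|) :=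
  ⟨fun _ _ _ _ _ _ _ _ hρ => traceNorm_haarMean_parallel_encrypt_sub_le hρ,
    fun _ _ _ _ _ _ _ _ _ W hm hV _ ht =>
      ⟨fun _ _ _ _ hρ A hA => hV.negligible_prob_parallel_encrypt_sub W hm ht hρ A hA,
        fun _ hρ A hA => hV.negligible_prob_tensorPow_encrypt_sub W hm ht hρ A hA⟩⟩

theorem theorem1 :
    (∃ C : ℝ, ∀ (n ℓ m t q : ℕ) (ρ : Op ((Fin t × Fin n) ⊕ (Fin t × Fin q))), IsDensity ρ →
      traceNorm (haarEncrypt ℓ m ρ -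
          tensor (tensorPow t (maxMixed (Fin (n + ℓ + m)))) (traceLeft ρ)) ≤
        C * ((t : ℝ) ^ 2 / 2 ^ m)) ∧
    ∀ (ℓ m κ₁ κ₂ κ₃ : ℕ → ℕ)
      (V₁ : ∀ n, Conf (Fin (κ₁ n)) → UGroup (Fin (n + ℓ n + m n)))
      (V₂ : ∀ n, Conf (Fin (κ₂ n)) → UGroup (Fin (n + ℓ n + m n)))
      (V₃ : ∀ n, Conf (Fin (κ₃ n)) → UGroup (Fin (n + ℓ n + m n)))
      (_ : (fun n : ℕ => Real.log n) =o[Filter.atTop] fun n : ℕ => (m n : ℝ))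
      (_ : IsPRU (fun n => n + ℓ n + m n) κ₁ V₁)
      (t : ℕ → ℕ) (_ : PolyBounded t),
      (∀ (q : ℕ → ℕ) (ρ : ∀ n, Op ((Fin (t n) × Fin n) ⊕ (Fin (t n) × Fin (q n)))),
        (∀ n, IsDensity (ρ n)) →
        ∀ A : ∀ n, Distinguisher ((Fin (t n) × Fin (n + ℓ n + m n)) ⊕ (Fin (t n) × Fin (q n))),
          PolyBounded (fun n => (A n).size) →
          Negligible fun n =>
            |uniformAvg (fun k => (A n).prob
                (parallel (t n) (encrypt (scrambler (V₁ n) (V₂ n) (V₃ n) k)) (ρ n))) -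
              (A n).prob (tensor (tensorPow (t n) (maxMixed (Fin (n + ℓ n + m n))))
                (traceLeft (ρ n)))|) ∧
      (∀ ρ : ∀ n, Op (Fin n), (∀ n, IsDensity (ρ n)) →
        ∀ A : ∀ n, Distinguisher (Fin (t n) × Fin (n + ℓ n + m n)),
          PolyBounded (fun n => (A n).size) →
          Negligible fun n =>
            |uniformAvg (fun k => (A n).prob
                (tensorPow (t n) (encrypt (scrambler (V₁ n) (V₂ n) (V₃ n) k) (ρ n)))) -
              (A n).prob (tensorPow (t n) (maxMixed (Fin (n + ℓ n + m n))))|) := by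
  refine ⟨⟨2, fun n ℓ m t q => theorem1_general.1 n ℓ m t _⟩,
    fun ℓ m κ₁ κ₂ κ₃ V₁ V₂ V₃ hm hV t ht => ?_⟩
  have h := theorem1_general.2 (fun n => n) ℓ m _ _ V₁
    (fun n (k : Conf (Fin (κ₂ n)) × Conf (Fin (κ₃ n))) => V₂ n k.1 * V₃ n k.2) hm
    hV.pseudorandom t ht
  simp only [← mul_assoc] at h
  exact ⟨fun q => h.1 _, h.2⟩
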